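/- Let $\mathsf h$ be a complex separable Hilbert space, $\mathcal B(\mathsf h)$ the algebra of bounded operators on $\mathsf h$, and $\mathfrak I_1(\mathsf h)$ the Banach space of trace class operators with the trace norm $\|\eta\|_1=\operatorname{tr}|\eta|$. The weak$^*$ topology of $\mathcal B(\mathsf h)$ is the one induced by the functionals $x\mapsto\operatorname{tr}(\eta x)$, $\eta\in\mathfrak I_1(\mathsf h)$. A quantum Markov semigroup (QMS) is a weak$^*$-continuous semigroup $\mathcal T=(\mathcal T_t)_{t\ge 0}$ of completely positive, identity preserving, normal (i.e. weak$^*$-continuous) linear maps on $\mathcal B(\mathsf h)$; its predual semigroup $(\mathcal T_{*t})_{t\ge0}$ on $\mathfrak I_1(\mathsf h)$ is determined by $\operatorname{tr}(\mathcal T_{*t}(\eta)x)=\operatorname{tr}(\eta\,\mathcal T_t(x))$ for all $x\in\mathcal B(\mathsf h)$. A density is a positive trace class operator of trace one; it is faithful if its range is dense in $\mathsf h$, and invariant if $\mathcal T_{*t}(\rho)=\rho$ for all $t\ge 0$. The QMS $\mathcal T$ is primitive if it has a unique faithful invariant density. **Theorem.** Let $\mathcal T$ be a primitive QMS and let $\rho$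 be its unique faithful invariant density. Then, for every density $\eta$ and every $t>0$, the function $s\mapsto\mathcal T_{*s}(\eta)$ is (Bochner) integrable on $[0,t]$ with values in $\mathfrak I_1(\mathsf h)$, the Cesàro mean $\frac1t\int_0^t\mathcal T_{*s}(\eta)\,ds$ is a density, and $$\lim_{t\to\infty}\Big\|\frac1t\int_0^t\mathcal T_{*s}(\eta)\,ds-\rho\Big\|_1=0 .$$ -/

import Mathlib

open scoped ENNReal NNReal InnerProductSpace

noncomputable section

namespace QuantumMarkov

variable {H : Type*} [NormedAddCommGroup H] [InnerProductSpace ℂ H] [CompleteSpace H]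

variable (H) in
/-- The index set of a fixed orthonormal basis of `H`. -/
def basisIndex : Set H := (exists_hilbertBasis ℂ H).choose

variable (H) in
/-- A fixed orthonormal (Hilbert) basis `(eᵢ)` of `H`, in which traces are computed (their values do
not depend on this choice). -/
def basis : HilbertBasis (basisIndex H) ℂ H := (exists_hilbertBasis ℂ H).choose_spec.choose

/-- `A` is trace class if `∑ᵢ ⟨eᵢ, |A| eᵢ⟩ < ∞`, where `|A| = (A* A)^{1/2}`. -/
def IsTraceClass (A : H →L[ℂ] H) : Prop :=
  Summable fun i => (⟪basis H i, CFC.abs A (basis H i)⟫_ℂ).re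

/-- The trace norm `‖A‖₁ = tr |A| = ∑ᵢ ⟨eᵢ, |A| eᵢ⟩`. -/
def traceNorm (A : H →L[ℂ] H) : ℝ :=
  ∑' i, (⟪basis H i, CFC.abs A (basis H i)⟫_ℂ).re

section Helpers

lemma polar (A : H →L[ℂ] H) : ∃ U : H →L[ℂ] H, ‖U‖ ≤ 1 ∧ U * CFC.abs A = A ∧
    star U * A = CFC.abs A := by
  set P := CFC.abs A with hP
  have hPs : star P = P := (CFC.abs_nonneg A).isSelfAdjoint.star_eq
  have hin : ∀ x y, ⟪A x, A y⟫_ℂ = ⟪P x, P y⟫_ℂ := by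
    intro x y
    have h := CFC.abs_mul_abs A
    rw [← ContinuousLinearMap.adjoint_inner_right, ← ContinuousLinearMap.adjoint_inner_right]
    have h1 := congrArg (fun f : H →L[ℂ] H => f y) h
    simp only [← hP] at h1
    rw [← ContinuousLinearMap.star_eq_adjoint, ← ContinuousLinearMap.star_eq_adjoint, hPs]
    exact congrArg _ h1.symm
  have hnorm : ∀ x, ‖A x‖ = ‖P x‖ := by
    intro x
    have h := hin x x
    rw [inner_self_eq_norm_sq_to_K, inner_self_eq_norm_sq_to_K] at h
    have h2 : ‖A x‖ ^ 2 = ‖P x‖ ^ 2 := by exact_mod_cast h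
    exact (sq_eq_sq₀ (norm_nonneg _) (norm_nonneg _)).1 h2
  set K : Submodule ℂ H := (LinearMap.range P.toLinearMap).topologicalClosure with hK
  have hmem : ∀ x, P x ∈ K := fun x => Submodule.le_topologicalClosure _ ⟨x, rfl⟩
  have : CompleteSpace K :=
    (Submodule.isClosed_topologicalClosure _).completeSpace_coe
  set e : H →ₗ[ℂ] K := P.toLinearMap.codRestrict K hmem with he
  have hd : DenseRange e := by
    intro y
    rw [closure_subtype]
    have hy : (y : H) ∈ closure (LinearMap.range P.toLinearMap : Set H) := y.2
    convert hy using 2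
    ext z
    constructor
    · rintro ⟨_, ⟨w, rfl⟩, rfl⟩; exact ⟨w, rfl⟩
    · rintro ⟨w, rfl⟩; exact ⟨e w, ⟨w, rfl⟩, rfl⟩
  have hb : ∀ x, ‖A.toLinearMap x‖ ≤ 1 * ‖e x‖ := by
    intro x; rw [one_mul]; exact (hnorm x).le
  set V := A.toLinearMap.extendOfNorm e with hV
  have hVe : ∀ x, V (e x) = A x := fun x => LinearMap.extendOfNorm_eq hd ⟨1, hb⟩ x
  refine ⟨V ∘L K.orthogonalProjectionOnto, ?_, ?_, ?_⟩
  · refine (ContinuousLinearMap.opNorm_comp_le _ _).trans ?_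
    exact mul_le_one₀ (LinearMap.opNorm_extendOfNorm_le hd zero_le_one hb) (norm_nonneg _)
      (Submodule.orthogonalProjectionOnto_norm_le K)
  · ext x
    change V (K.orthogonalProjectionOnto (P x)) = A x
    rw [← hVe]
    congr 1
    exact Submodule.orthogonalProjectionOnto_mem_subspace_eq_self (⟨P x, hmem x⟩ : K)
  · ext x
    refine ext_inner_right ℂ fun y => ?_
    change ⟪star (V ∘L K.orthogonalProjectionOnto) (A x), y⟫_ℂ = ⟪P x, y⟫_ℂ
    rw [ContinuousLinearMap.star_eq_adjoint, ContinuousLinearMap.adjoint_inner_left]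
    change ⟪A x, V (K.orthogonalProjectionOnto y)⟫_ℂ = _
    have key : ∀ z : K, ⟪A x, V z⟫_ℂ = ⟪P x, (z : H)⟫_ℂ := by
      intro z
      refine hd.induction_on (p := fun z : K => ⟪A x, V z⟫_ℂ = ⟪P x, (z : H)⟫_ℂ) z ?_ ?_
      · exact isClosed_eq (by fun_prop) (by fun_prop)
      · intro w; rw [hVe, hin]; rfl
    rw [key]
    exact Submodule.inner_orthogonalProjectionOnto_eq_of_mem_left (⟨P x, hmem x⟩ : K) y

/-- Sum of the squares of the column norms (the squared Hilbert--Schmidt norm). -/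
def hsSq (C : H →L[ℂ] H) : ℝ≥0∞ := ∑' i, ‖C (basis H i)‖ₑ ^ 2

lemma enorm_sq_eq_tsum (x : H) : ‖x‖ₑ ^ 2 = ∑' j, ‖⟪basis H j, x⟫_ℂ‖ₑ ^ 2 := by
  have h := (basis H).hasSum_inner_mul_inner x x
  have h2 : HasSum (fun j => ‖⟪basis H j, x⟫_ℂ‖ ^ 2) (‖x‖ ^ 2) := by
    have := Complex.hasSum_re h
    rw [inner_self_eq_norm_sq_to_K] at this
    convert this using 1
    · ext j
      rw [← inner_conj_symm x, RCLike.conj_mul]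
      norm_cast
    · norm_cast
  have h3 : ∀ y : ℝ, 0 ≤ y → ENNReal.ofReal (y ^ 2) = (ENNReal.ofReal y) ^ 2 := fun y hy =>
    ENNReal.ofReal_pow hy 2
  rw [← ofReal_norm, ← h3 _ (norm_nonneg _), ← h2.tsum_eq,
    ENNReal.ofReal_tsum_of_nonneg (fun _ => by positivity) h2.summable]
  simp_rw [h3 _ (norm_nonneg _), ofReal_norm]

lemma hsSq_star (C : H →L[ℂ] H) : hsSq (star C) = hsSq C := by
  unfold hsSq
  rw [tsum_congr fun i => enorm_sq_eq_tsum ((star C) (basis H i)),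
    tsum_congr fun i => enorm_sq_eq_tsum (C (basis H i)), ENNReal.tsum_comm]
  refine tsum_congr fun i => tsum_congr fun j => ?_
  rw [ContinuousLinearMap.star_eq_adjoint, ContinuousLinearMap.adjoint_inner_right,
    ← inner_conj_symm, RCLike.enorm_conj]

lemma hsSq_mul_le (X C : H →L[ℂ] H) : hsSq (X * C) ≤ ‖X‖ₑ ^ 2 * hsSq C := by
  unfold hsSq
  rw [← ENNReal.tsum_mul_left]
  refine ENNReal.tsum_le_tsum fun i => ?_
  rw [← mul_pow]
  gcongr
  exact X.le_opENorm _

lemma hsSq_mul_le' (X C : H →L[ℂ] H) : hsSq (C * X) ≤ ‖X‖ₑ ^ 2 * hsSq C := by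
  rw [← hsSq_star, star_mul, ← hsSq_star C]
  refine (hsSq_mul_le _ _).trans_eq ?_
  rw [enorm_eq_nnnorm, nnnorm_star, enorm_eq_nnnorm]

lemma inner_star_mul (F G : H →L[ℂ] H) (x : H) : ⟪x, (star F * G) x⟫_ℂ = ⟪F x, G x⟫_ℂ := by
  rw [ContinuousLinearMap.star_eq_adjoint]
  exact ContinuousLinearMap.adjoint_inner_right F x (G x)

lemma tsum_inner_le (X C Y : H →L[ℂ] H) (hC : star C = C) :
    2 * ∑' i, ‖⟪basis H i, (X * (C * C) * Y) (basis H i)⟫_ℂ‖ₑ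
      ≤ (‖X‖ₑ ^ 2 + ‖Y‖ₑ ^ 2) * hsSq C := by
  have h1 : ∀ i, 2 * ‖⟪basis H i, (X * (C * C) * Y) (basis H i)⟫_ℂ‖ₑ
      ≤ ‖(C * star X) (basis H i)‖ₑ ^ 2 + ‖(C * Y) (basis H i)‖ₑ ^ 2 := by
    intro i
    generalize (basis H i : H) = b
    have h2 : ⟪b, (X * (C * C) * Y) b⟫_ℂ = ⟪(C * star X) b, (C * Y) b⟫_ℂ := by
      have : X * (C * C) * Y = star (C * star X) * (C * Y) := by
        rw [star_mul, star_star, hC]; simp only [mul_assoc]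
      rw [this, inner_star_mul]
    have h3 : 2 * ‖⟪b, (X * (C * C) * Y) b⟫_ℂ‖ ≤ ‖(C * star X) b‖ ^ 2 + ‖(C * Y) b‖ ^ 2 := by
      rw [h2]
      have := norm_inner_le_norm (𝕜 := ℂ) ((C * star X) b) ((C * Y) b)
      nlinarith [sq_nonneg (‖(C * star X) b‖ - ‖(C * Y) b‖)]
    have h4 := ENNReal.ofReal_le_ofReal h3
    rw [ENNReal.ofReal_mul (by norm_num), ENNReal.ofReal_add (by positivity) (by positivity),
      ENNReal.ofReal_pow (norm_nonneg _), ENNReal.ofReal_pow (norm_nonneg _)] at h4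
    simpa only [ofReal_norm, ENNReal.ofReal_ofNat] using h4
  rw [← ENNReal.tsum_mul_left]
  refine (ENNReal.tsum_le_tsum h1).trans ?_
  rw [ENNReal.tsum_add, add_mul]
  refine add_le_add ?_ (hsSq_mul_le' Y C)
  refine (hsSq_mul_le' (star X) C).trans_eq ?_
  rw [enorm_eq_nnnorm, nnnorm_star, enorm_eq_nnnorm]

/-- The trace norm with values in `[0, ∞]`. -/
def eTraceNorm (A : H →L[ℂ] H) : ℝ≥0∞ :=
  ∑' i, ENNReal.ofReal (⟪basis H i, CFC.abs A (basis H i)⟫_ℂ).re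

lemma re_inner_abs_nonneg (A : H →L[ℂ] H) (x : H) : 0 ≤ (⟪x, CFC.abs A x⟫_ℂ).re := by
  have h := (ContinuousLinearMap.nonneg_iff_isPositive _).1 (CFC.abs_nonneg A)
  exact h.re_inner_nonneg_right x

lemma isTraceClass_iff {A : H →L[ℂ] H} : IsTraceClass A ↔ eTraceNorm A ≠ ∞ := by
  constructor
  · intro h
    exact h.tsum_ofReal_ne_top
  · intro h
    have := ENNReal.summable_toReal h
    refine this.congr fun i => ?_
    rw [ENNReal.toReal_ofReal (re_inner_abs_nonneg _ _)]

lemma traceNorm_eq (A : H →L[ℂ] H) : traceNorm A = (eTraceNorm A).toReal := by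
  unfold traceNorm eTraceNorm
  rw [ENNReal.tsum_toReal_eq (fun _ => ENNReal.ofReal_ne_top)]
  exact tsum_congr fun i => (ENNReal.toReal_ofReal (re_inner_abs_nonneg _ _)).symm

lemma exists_factor (A : H →L[ℂ] H) : ∃ U C : H →L[ℂ] H, ‖U‖ₑ ≤ 1 ∧ star C = C ∧
    A = U * (C * C) ∧ star U * A = CFC.abs A ∧ CFC.abs A = C * C ∧ eTraceNorm A = hsSq C := by
  obtain ⟨U, hU, h1, h2⟩ := polar A
  have hC : star (CFC.sqrt (CFC.abs A)) = CFC.sqrt (CFC.abs A) :=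
    (CFC.sqrt_nonneg _).isSelfAdjoint.star_eq
  have hCC : CFC.sqrt (CFC.abs A) * CFC.sqrt (CFC.abs A) = CFC.abs A :=
    CFC.sqrt_mul_sqrt_self _ (CFC.abs_nonneg A)
  refine ⟨U, CFC.sqrt (CFC.abs A), ?_, hC, ?_, h2, hCC.symm, ?_⟩
  · rw [← ofReal_norm]; exact ENNReal.ofReal_le_one.2 hU
  · rw [hCC, h1]
  · unfold eTraceNorm hsSq
    refine tsum_congr fun i => ?_
    conv_lhs => rw [← hCC]
    set C := CFC.sqrt (CFC.abs A)
    have : ⟪basis H i, (C * C) (basis H i)⟫_ℂ = ⟪C (basis H i), C (basis H i)⟫_ℂ := by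
      rw [← inner_star_mul, hC]
    rw [this, inner_self_eq_norm_sq_to_K, ← ofReal_norm, ← ENNReal.ofReal_pow (norm_nonneg _)]
    norm_cast

lemma ofReal_re_le_enorm (z : ℂ) : ENNReal.ofReal z.re ≤ ‖z‖ₑ := by
  rw [← ofReal_norm]
  exact ENNReal.ofReal_le_ofReal (Complex.re_le_norm z)

lemma eTraceNorm_add_le (A B : H →L[ℂ] H) :
    eTraceNorm (A + B) ≤ eTraceNorm A + eTraceNorm B := by
  obtain ⟨V, -, hV, -, -, hVs, -, -⟩ := exists_factor (A + B)
  have key : ∀ A : H →L[ℂ] H,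
      ∑' i, ‖⟪basis H i, (star V * A) (basis H i)⟫_ℂ‖ₑ ≤ eTraceNorm A := by
    intro A
    obtain ⟨U, C, hU, hC, hA, -, -, hN⟩ := exists_factor A
    have h := tsum_inner_le (star V * U) C 1 hC
    have h1 : star V * U * (C * C) * 1 = star V * A := by rw [hA, mul_one, mul_assoc]
    have h2 : ‖star V * U‖ₑ ≤ 1 := by
      rw [← ofReal_norm] at hV hU ⊢
      rw [ENNReal.ofReal_le_one] at hV hU ⊢
      refine (norm_mul_le _ _).trans (mul_le_one₀ ?_ (norm_nonneg _) hU)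
      rwa [norm_star]
    have h3 : ‖(1 : H →L[ℂ] H)‖ₑ ≤ 1 := by
      rw [← ofReal_norm, ENNReal.ofReal_le_one]
      exact ContinuousLinearMap.norm_id_le
    rw [h1, ← hN] at h
    have h4 : 2 * ∑' i, ‖⟪basis H i, (star V * A) (basis H i)⟫_ℂ‖ₑ ≤ 2 * eTraceNorm A := by
      refine h.trans ?_
      gcongr
      calc ‖star V * U‖ₑ ^ 2 + ‖(1 : H →L[ℂ] H)‖ₑ ^ 2 ≤ 1 ^ 2 + 1 ^ 2 := by gcongr
        _ = 2 := by norm_num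
    exact (ENNReal.mul_le_mul_iff_right (by norm_num) (by norm_num)).1 h4
  refine le_trans ?_ (add_le_add (key A) (key B))
  rw [← ENNReal.tsum_add, eTraceNorm]
  refine ENNReal.tsum_le_tsum fun i => ?_
  rw [← hVs]
  refine (ofReal_re_le_enorm _).trans ?_
  rw [mul_add, add_apply, inner_add_right]
  exact enorm_add_le _ _

lemma eTraceNorm_smul (c : ℂ) (A : H →L[ℂ] H) : eTraceNorm (c • A) = ‖c‖ₑ * eTraceNorm A := by
  unfold eTraceNorm
  rw [← ENNReal.tsum_mul_left]
  refine tsum_congr fun i => ?_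
  rw [CFC.abs_smul, ← ofReal_norm, ← ENNReal.ofReal_mul (norm_nonneg _)]
  congr 1
  rw [smul_apply, ← Complex.coe_smul, inner_smul_right]
  simp

lemma enorm_le_eTraceNorm (A : H →L[ℂ] H) : ‖A‖ₑ ≤ eTraceNorm A := by
  obtain ⟨U, C, hU, hC, hA, -, -, hN⟩ := exists_factor A
  rw [hN]
  by_cases hfin : hsSq C = ∞
  · rw [hfin]; exact le_top
  have h1 : ∀ x, ‖C x‖ₑ ^ 2 ≤ hsSq C * ‖x‖ₑ ^ 2 := by
    intro x
    rw [enorm_sq_eq_tsum, hsSq, ← ENNReal.tsum_mul_right]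
    refine ENNReal.tsum_le_tsum fun j => ?_
    rw [← mul_pow]
    gcongr
    have h2 : ⟪basis H j, C x⟫_ℂ = ⟪C (basis H j), x⟫_ℂ := by
      conv_lhs => rw [← hC, ContinuousLinearMap.star_eq_adjoint]
      exact ContinuousLinearMap.adjoint_inner_right C _ _
    rw [h2, ← ofReal_norm, ← ofReal_norm, ← ofReal_norm, ← ENNReal.ofReal_mul (norm_nonneg _)]
    exact ENNReal.ofReal_le_ofReal (norm_inner_le_norm _ _)
  set r := (hsSq C).toReal with hr
  have h2 : ‖C‖ ≤ √r := by
    refine ContinuousLinearMap.opNorm_le_bound _ (Real.sqrt_nonneg _) fun x => ?_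
    have h3 := ENNReal.toReal_mono (by finiteness) (h1 x)
    rw [ENNReal.toReal_mul, ENNReal.toReal_pow, ENNReal.toReal_pow, toReal_enorm, toReal_enorm,
      ← hr] at h3
    refine Real.le_sqrt_of_sq_le h3 |>.trans_eq ?_
    rw [Real.sqrt_mul' _ (by positivity), Real.sqrt_sq (norm_nonneg _)]
  have h3 : ‖A‖ ≤ r := by
    rw [← ofReal_norm, ENNReal.ofReal_le_one] at hU
    calc ‖A‖ ≤ ‖U‖ * (‖C‖ * ‖C‖) := by
          rw [hA]
          exact (norm_mul_le _ _).trans (by gcongr; exact norm_mul_le _ _)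
      _ ≤ 1 * (√r * √r) := by gcongr
      _ = r := by rw [one_mul, Real.mul_self_sqrt ENNReal.toReal_nonneg]
  rw [← ofReal_norm]
  exact ENNReal.ofReal_le_of_le_toReal h3

lemma lowerSemicontinuous_eTraceNorm :
    LowerSemicontinuous (eTraceNorm : (H →L[ℂ] H) → ℝ≥0∞) := by
  refine lowerSemicontinuous_tsum fun i => Continuous.lowerSemicontinuous ?_
  have : Continuous (CFC.abs : (H →L[ℂ] H) → (H →L[ℂ] H)) := CFC.continuous_abs
  exact ENNReal.continuous_ofReal.comp (Complex.continuous_re.comp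
    (Continuous.inner continuous_const (this.clm_apply continuous_const)))

lemma IsTraceClass.mul_right {A : H →L[ℂ] H} (hA : IsTraceClass A) (x : H →L[ℂ] H) :
    IsTraceClass (A * x) := by
  rw [isTraceClass_iff] at hA ⊢
  obtain ⟨V, -, hV, -, -, hVs, -, -⟩ := exists_factor (A * x)
  obtain ⟨U, C, hU, hC, hA', -, -, hN⟩ := exists_factor A
  have h := tsum_inner_le (star V * U) C x hC
  have h1 : star V * U * (C * C) * x = CFC.abs (A * x) := by
    rw [← hVs, hA']; simp only [mul_assoc]
  rw [h1, ← hN] at h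
  have h2 : eTraceNorm (A * x) ≤
      2 * ∑' i, ‖⟪basis H i, CFC.abs (A * x) (basis H i)⟫_ℂ‖ₑ := by
    refine le_trans (ENNReal.tsum_le_tsum fun i => ofReal_re_le_enorm _) ?_
    exact le_mul_of_one_le_left zero_le (by norm_num)
  refine ne_top_of_le_ne_top ?_ (h2.trans h)
  finiteness

lemma IsTraceClass.summable_inner {A : H →L[ℂ] H} (hA : IsTraceClass A) :
    Summable fun i => ⟪basis H i, A (basis H i)⟫_ℂ := by
  rw [isTraceClass_iff] at hA
  obtain ⟨U, C, hU, hC, hA', -, -, hN⟩ := exists_factor A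
  have h := tsum_inner_le U C 1 hC
  rw [mul_one, ← hA', ← hN] at h
  have h2 : ∑' i, ‖⟪basis H i, A (basis H i)⟫_ℂ‖ₑ ≠ ∞ := by
    intro h3
    rw [h3, ENNReal.mul_top (by norm_num), top_le_iff] at h
    exact absurd h (by finiteness)
  refine Summable.of_norm ?_
  refine (ENNReal.summable_toReal h2).congr fun i => ?_
  exact toReal_enorm _

end Helpers

variable (H) in
/-- The linear space of trace class operators. -/
def traceClassSubmodule : Submodule ℂ (H →L[ℂ] H) where
  carrier := {A | IsTraceClass A}
  add_mem' {A B} hA hB := by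
    rw [Set.mem_ofPred_eq, isTraceClass_iff] at *
    exact ne_top_of_le_ne_top (ENNReal.add_ne_top.2 ⟨hA, hB⟩) (eTraceNorm_add_le A B)
  zero_mem' := by
    rw [Set.mem_ofPred_eq, isTraceClass_iff]
    simp [eTraceNorm]
  smul_mem' c A hA := by
    rw [Set.mem_ofPred_eq, isTraceClass_iff] at *
    rw [eTraceNorm_smul]
    finiteness

variable (H) in
/-- The space `𝔗₁(H)` of trace class operators; it carries the trace norm (not the operator norm),
see the instances below. -/
def TraceClass : Type _ := traceClassSubmodule H

namespace TraceClass

instance : AddCommGroup (TraceClass H) := inferInstanceAs (AddCommGroup (traceClassSubmodule H))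

instance : Module ℂ (TraceClass H) := inferInstanceAs (Module ℂ (traceClassSubmodule H))

/-- The underlying bounded operator, as a linear inclusion `𝔗₁(H) → B(H)`. -/
def toOp : TraceClass H →ₗ[ℂ] (H →L[ℂ] H) := (traceClassSubmodule H).subtype

lemma isTraceClass (η : TraceClass H) : IsTraceClass (toOp η) := η.2

lemma toOp_injective : Function.Injective (toOp : TraceClass H → (H →L[ℂ] H)) :=
  Subtype.val_injective

/-- A trace class operator as an element of `TraceClass H`. -/
def mk (A : H →L[ℂ] H) (hA : IsTraceClass A) : TraceClass H := ⟨A, hA⟩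

@[simp] lemma toOp_mk (A : H →L[ℂ] H) (hA : IsTraceClass A) : toOp (mk A hA) = A := rfl

instance : Norm (TraceClass H) := ⟨fun η => traceNorm (toOp η)⟩

lemma norm_def (η : TraceClass H) : ‖η‖ = traceNorm (toOp η) := rfl

lemma core : NormedSpace.Core ℂ (TraceClass H) where
  norm_nonneg η := by rw [norm_def, traceNorm_eq]; exact ENNReal.toReal_nonneg
  norm_smul c η := by
    rw [norm_def, norm_def, traceNorm_eq, traceNorm_eq, map_smul, eTraceNorm_smul,
      ENNReal.toReal_mul, toReal_enorm]
  norm_triangle η ζ := by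
    simp only [norm_def, traceNorm_eq, map_add]
    have h1 := isTraceClass_iff.1 η.isTraceClass
    have h2 := isTraceClass_iff.1 ζ.isTraceClass
    rw [← ENNReal.toReal_add h1 h2]
    exact ENNReal.toReal_mono (ENNReal.add_ne_top.2 ⟨h1, h2⟩) (eTraceNorm_add_le _ _)
  norm_eq_zero_iff η := by
    constructor
    · intro h
      rw [norm_def, traceNorm_eq, ENNReal.toReal_eq_zero_iff] at h
      rcases h with h | h
      · have h1 := enorm_le_eTraceNorm (toOp η)
        rw [h, le_zero_iff, enorm_eq_zero] at h1
        exact toOp_injective (by rw [h1, map_zero])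
      · exact absurd h (isTraceClass_iff.1 η.isTraceClass)
    · rintro rfl
      rw [norm_def, traceNorm_eq, map_zero]
      simp [eTraceNorm]

instance : NormedAddCommGroup (TraceClass H) := NormedAddCommGroup.ofCore core

instance : NormedSpace ℂ (TraceClass H) := NormedSpace.ofCore core

lemma eTraceNorm_toOp (η : TraceClass H) : eTraceNorm (toOp η) = ENNReal.ofReal ‖η‖ := by
  rw [norm_def, traceNorm_eq, ENNReal.ofReal_toReal (isTraceClass_iff.1 η.isTraceClass)]

lemma norm_toOp_le (η : TraceClass H) : ‖toOp η‖ ≤ ‖η‖ := by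
  have h := enorm_le_eTraceNorm (toOp η)
  rw [eTraceNorm_toOp, ← ofReal_norm] at h
  exact (ENNReal.ofReal_le_ofReal_iff (norm_nonneg _)).1 h

instance : CompleteSpace (TraceClass H) := by
  refine Metric.complete_of_cauchySeq_tendsto fun u hu => ?_
  have hu' : CauchySeq fun n => toOp (u n) := by
    rw [Metric.cauchySeq_iff] at hu ⊢
    intro ε hε
    obtain ⟨N, hN⟩ := hu ε hε
    refine ⟨N, fun m hm n hn => lt_of_le_of_lt ?_ (hN m hm n hn)⟩
    rw [dist_eq_norm, dist_eq_norm, ← map_sub]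
    exact norm_toOp_le _
  obtain ⟨A, hA⟩ := cauchySeq_tendsto_of_complete hu'
  have key : ∀ ε > 0, ∃ N, ∀ n ≥ N, eTraceNorm (A - toOp (u n)) ≤ ENNReal.ofReal ε := by
    intro ε hε
    obtain ⟨N, hN⟩ := Metric.cauchySeq_iff.1 hu ε hε
    refine ⟨N, fun n hn => ?_⟩
    have hcl := lowerSemicontinuous_eTraceNorm (H := H) |>.isClosed_preimage (ENNReal.ofReal ε)
    refine hcl.mem_of_tendsto (hA.sub_const (toOp (u n))) ?_
    filter_upwards [Filter.eventually_ge_atTop N] with m hm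
    have h := (hN m hm n hn).le
    rw [Set.mem_preimage, Set.mem_Iic, ← map_sub, eTraceNorm_toOp]
    rw [dist_eq_norm] at h
    exact ENNReal.ofReal_le_ofReal h
  obtain ⟨N, hN⟩ := key 1 one_pos
  have h1 : IsTraceClass (A - toOp (u N)) :=
    isTraceClass_iff.2 (ne_top_of_le_ne_top ENNReal.ofReal_ne_top (hN N le_rfl))
  have h2 : IsTraceClass A := by
    have := (traceClassSubmodule H).add_mem h1 (u N).isTraceClass
    rwa [sub_add_cancel] at this
  refine ⟨mk A h2, Metric.tendsto_atTop'.2 fun ε hε => ?_⟩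
  obtain ⟨M, hM⟩ := key (ε / 2) (by positivity)
  refine ⟨M, fun n hn => ?_⟩
  have h3 := hM n hn.le
  have h4 : A - toOp (u n) = toOp (mk A h2 - u n) := by rw [map_sub, toOp_mk]
  rw [h4, eTraceNorm_toOp, ENNReal.ofReal_le_ofReal_iff (by positivity)] at h3
  rw [dist_comm, dist_eq_norm]
  linarith

/-- The trace `tr η = ∑ᵢ ⟨eᵢ, η eᵢ⟩`. -/
def trace : TraceClass H →ₗ[ℂ] ℂ where
  toFun η := ∑' i, ⟪basis H i, toOp η (basis H i)⟫_ℂ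
  map_add' η ζ := by
    rw [← η.isTraceClass.summable_inner.tsum_add ζ.isTraceClass.summable_inner]
    refine tsum_congr fun i => ?_
    rw [map_add, add_apply, inner_add_right]
  map_smul' c η := by
    rw [RingHom.id_apply, smul_eq_mul, ← tsum_mul_left]
    refine tsum_congr fun i => ?_
    rw [map_smul, smul_apply, inner_smul_right]

/-- The product `η x` of a trace class operator `η` and a bounded operator `x`. -/
def mulOp (η : TraceClass H) (x : H →L[ℂ] H) : TraceClass H :=
  mk (toOp η * x) (η.isTraceClass.mul_right x)

end TraceClass

variable (H) in
/-- The duality `(x, η) ↦ tr (η x)` between `B(H)` and the trace class operators. -/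
def pairing : (H →L[ℂ] H) →ₗ[ℂ] TraceClass H →ₗ[ℂ] ℂ :=
  LinearMap.mk₂ ℂ (fun x η => (η.mulOp x).trace)
    (fun x y η => by
      rw [← map_add]; congr 1; apply TraceClass.toOp_injective
      simp [TraceClass.mulOp, mul_add])
    (fun c x η => by
      rw [← map_smul]; congr 1; apply TraceClass.toOp_injective
      simp only [TraceClass.mulOp, TraceClass.toOp_mk, map_smul, mul_smul_comm])
    (fun x η ζ => by
      rw [← map_add]; rfl)
    (fun c x η => by
      rw [← map_smul]; rfl)

variable (H) in
/-- `B(H)` with the weak* topology `σ(B(H), 𝔗₁(H))`. -/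
abbrev WeakStarOp : Type _ := WeakBilin (pairing H)

/-- The identity map, `B(H)` to `B(H)` with the weak* topology. -/
def toWeakStar : (H →L[ℂ] H) ≃ₗ[ℂ] WeakStarOp H := LinearEquiv.refl ℂ (H →L[ℂ] H)

/-- A linear map of `B(H)` is normal if it is continuous for the weak* topology. -/
def IsNormalMap (Φ : (H →L[ℂ] H) →ₗ[ℂ] (H →L[ℂ] H)) : Prop :=
  Continuous fun x : WeakStarOp H => toWeakStar (Φ (toWeakStar.symm x))

variable (H) in
/-- A quantum Markov semigroup on `B(H)`: a weak*-continuous semigroup of completely positive,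
identity preserving, normal linear maps. -/
structure QuantumMarkovSemigroup where
  /-- The maps `𝒯ₜ`, `t ≥ 0`, completely positive by type. -/
  map : ℝ≥0 → CompletelyPositiveMap (H →L[ℂ] H) (H →L[ℂ] H)
  map_zero : ∀ x, map 0 x = x
  map_add : ∀ s t x, map (s + t) x = map s (map t x)
  map_one : ∀ t, map t 1 = 1
  normal : ∀ t, IsNormalMap (map t).toLinearMap
  weakStar_continuous : ∀ x, Continuous fun t => toWeakStar (map t x)

namespace QuantumMarkovSemigroup

variable (T : QuantumMarkovSemigroup H)

lemma exists_predual (t : ℝ≥0) (η : TraceClass H) :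
    ∃ ζ : TraceClass H, ∀ x, (ζ.mulOp x).trace = (η.mulOp (T.map t x)).trace := by
  let f : StrongDual ℂ (WeakStarOp H) :=
    (WeakBilin.eval (pairing H) η).comp
      ⟨toWeakStar.toLinearMap ∘ₗ (T.map t).toLinearMap ∘ₗ toWeakStar.symm.toLinearMap, T.normal t⟩
  obtain ⟨ζ, hζ⟩ := LinearMap.dualEmbedding_surjective (pairing H) f
  exact ⟨ζ, fun x => congrArg (fun g : StrongDual ℂ (WeakStarOp H) => g (toWeakStar x)) hζ⟩

/-- The predual semigroup `𝒯_{*t}` on the trace class operators: `𝒯_{*t}(η)` is the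
trace class operator with `tr (𝒯_{*t}(η) x) = tr (η 𝒯ₜ(x))` for all `x ∈ B(H)`. -/
def predual (t : ℝ≥0) (η : TraceClass H) : TraceClass H := (T.exists_predual t η).choose

lemma trace_predual_mulOp (t : ℝ≥0) (η : TraceClass H) (x : H →L[ℂ] H) :
    ((T.predual t η).mulOp x).trace = (η.mulOp (T.map t x)).trace :=
  (T.exists_predual t η).choose_spec x

end QuantumMarkovSemigroup

/-- A trace class operator is determined by its pairing with `B(H)`; in particular the predual
maps above are uniquely determined. -/
lemma eq_of_trace_mulOp_eq {η ζ : TraceClass H}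
    (h : ∀ x, (η.mulOp x).trace = (ζ.mulOp x).trace) : η = ζ := by
  apply TraceClass.toOp_injective
  have key : ∀ (η : TraceClass H) (u v : H), (η.mulOp (InnerProductSpace.rankOne ℂ u v)).trace =
      ⟪v, η.toOp u⟫_ℂ := by
    intro η u v
    change ∑' i, ⟪basis H i, η.toOp ((InnerProductSpace.rankOne ℂ u v) (basis H i))⟫_ℂ = _
    rw [← (basis H).tsum_inner_mul_inner v (η.toOp u)]
    refine tsum_congr fun i => ?_
    rw [InnerProductSpace.rankOne_apply, map_smul, inner_smul_right]
  ext u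
  refine ext_inner_left ℂ fun v => ?_
  rw [← key, ← key, h]

/-- A density: a positive trace class operator of unit trace. -/
structure IsDensity (ρ : TraceClass H) : Prop where
  nonneg : 0 ≤ ρ.toOp
  trace_eq_one : ρ.trace = 1

/-- The support (closure of the range) is the whole space. -/
def IsFaithful (ρ : TraceClass H) : Prop := closure (Set.range ρ.toOp) = Set.univ

namespace QuantumMarkovSemigroup

variable (T : QuantumMarkovSemigroup H)

/-- `ρ` is invariant: `𝒯_{*t}(ρ) = ρ` for all `t ≥ 0`. -/
def IsInvariant (ρ : TraceClass H) : Prop := ∀ t, T.predual t ρ = ρ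

/-- `T` is primitive if it has a unique faithful invariant density. -/
def IsPrimitive : Prop := ∃! ρ : TraceClass H, IsDensity ρ ∧ IsFaithful ρ ∧ T.IsInvariant ρ

/-- The Cesàro mean `t⁻¹ ∫₀ᵗ 𝒯_{*s}(η) ds` (Bochner integral for the trace norm). -/
def cesaroMean (η : TraceClass H) (t : ℝ) : TraceClass H :=
  t⁻¹ • ∫ s in (0 : ℝ)..t, T.predual s.toNNReal η

end QuantumMarkovSemigroup

end QuantumMarkov

end

/-! The faithful invariant density `ρ` prevents mass from escaping to infinity. Every density `η` is
absolutely continuous with respect to `ρ`: for `0 ≤ x ≤ 1`, `tr (η x) ≤ ε + c tr (ρ x)` with `c`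
independent of `x` (`exists_re_traceMul_le`). Taking `x = 𝒯ₛ(1 - P)` with `P` a finite-rank basis
projection, invariance of `ρ` turns the right side into `ε + c tr (ρ (1 - P))`, so the orbit of `η`
is tight uniformly in `s` (`exists_traceMul_predual_le`), and so are its averages.

For densities, tightness is compactness: a density with little mass outside `P` is trace-norm close
to its compression by `P` (`norm_sub_ofMatrix_entries_le`), and compressions form a bounded set in
finite dimension (`totallyBounded_of_tight`). The same estimate upgrades entrywise convergence of
densities to norm convergence, which makes orbits norm continuous and hence integrable.

The Cesàro means therefore stay in a compact set of densities. Their cluster points are invariant,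
since shifting the window of integration costs `O(1/t)`. An invariant density `σ` must be `ρ`,
because `(ρ + σ)/2` is again faithful and invariant (`IsPrimitive.eq_of_isInvariant`). With one
possible cluster point in a compact set, the means converge. -/

noncomputable section

open scoped ComplexOrder

namespace QuantumMarkov

variable {H : Type*} [NormedAddCommGroup H] [InnerProductSpace ℂ H] [CompleteSpace H]

/-! ### Hilbert–Schmidt estimates and cyclicity of the trace. -/

section HilbertSchmidt

/-- Polar decomposition gives `|AB| = V* A B` with `V` a contraction, so each diagonal entry is `⟪A*
V e, B e⟫`; the arithmetic–geometric mean inequality splits it, and `V` does not increase the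
Hilbert–Schmidt norm. -/
lemma two_mul_eTraceNorm_mul_le (A B : H →L[ℂ] H) :
    2 * eTraceNorm (A * B) ≤ hsSq A + hsSq B := by
  obtain ⟨V, -, hV, -, -, hVs, -, -⟩ := exists_factor (A * B)
  have h1 : ∀ i, 2 * ENNReal.ofReal (⟪basis H i, CFC.abs (A * B) (basis H i)⟫_ℂ).re
      ≤ ‖(star A * V) (basis H i)‖ₑ ^ 2 + ‖B (basis H i)‖ₑ ^ 2 := by
    intro i
    generalize (basis H i : H) = b
    have h2 : ⟪b, CFC.abs (A * B) b⟫_ℂ = ⟪(star A * V) b, B b⟫_ℂ := by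
      rw [← hVs, ← inner_star_mul, star_mul, star_star, mul_assoc]
    have h3 : 2 * (⟪b, CFC.abs (A * B) b⟫_ℂ).re ≤ ‖(star A * V) b‖ ^ 2 + ‖B b‖ ^ 2 := by
      rw [h2]
      have := (Complex.re_le_norm _).trans (norm_inner_le_norm (𝕜 := ℂ) ((star A * V) b) (B b))
      nlinarith [sq_nonneg (‖(star A * V) b‖ - ‖B b‖)]
    have h4 := ENNReal.ofReal_le_ofReal h3
    rw [ENNReal.ofReal_mul (by norm_num), ENNReal.ofReal_add (by positivity) (by positivity),
      ENNReal.ofReal_pow (norm_nonneg _), ENNReal.ofReal_pow (norm_nonneg _)] at h4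
    simpa only [ofReal_norm, ENNReal.ofReal_ofNat] using h4
  rw [eTraceNorm, ← ENNReal.tsum_mul_left]
  refine (ENNReal.tsum_le_tsum h1).trans ?_
  rw [ENNReal.tsum_add]
  refine add_le_add ?_ le_rfl
  calc hsSq (star A * V) ≤ ‖V‖ₑ ^ 2 * hsSq (star A) := hsSq_mul_le' V (star A)
    _ ≤ 1 ^ 2 * hsSq A := by rw [hsSq_star]; gcongr
    _ = hsSq A := by simp

lemma hsSq_smul (c : ℂ) (A : H →L[ℂ] H) : hsSq (c • A) = ‖c‖ₑ ^ 2 * hsSq A := by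
  unfold hsSq
  rw [← ENNReal.tsum_mul_left]
  refine tsum_congr fun i => ?_
  rw [smul_apply, enorm_smul, mul_pow]

/-- Scaling `A` by `c` and `B` by `c⁻¹` leaves the product unchanged. The free weight recovers the
strength of Cauchy–Schwarz: one small factor suffices for a small product. -/
lemma eTraceNorm_mul_le_of_hsSq_le {A B : H →L[ℂ] H} {a b c : ℝ} (hc : 0 < c) (ha : 0 ≤ a)
    (hb : 0 ≤ b) (hA : hsSq A ≤ ENNReal.ofReal a) (hB : hsSq B ≤ ENNReal.ofReal b) :
    2 * eTraceNorm (A * B) ≤ ENNReal.ofReal (c ^ 2 * a + c⁻¹ ^ 2 * b) := by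
  have hc' : (c : ℂ) ≠ 0 := by exact_mod_cast hc.ne'
  have h := two_mul_eTraceNorm_mul_le ((c : ℂ) • A) ((c : ℂ)⁻¹ • B)
  rw [smul_mul_smul_comm, mul_inv_cancel₀ hc', one_smul, hsSq_smul, hsSq_smul] at h
  have h1 : ‖(c : ℂ)‖ₑ = ENNReal.ofReal c := by
    rw [← ofReal_norm, Complex.norm_real, Real.norm_of_nonneg hc.le]
  have h2 : ‖(c : ℂ)⁻¹‖ₑ = ENNReal.ofReal c⁻¹ := by
    rw [← ofReal_norm, norm_inv, Complex.norm_real, Real.norm_of_nonneg hc.le]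
  rw [h1, h2, ← ENNReal.ofReal_pow hc.le, ← ENNReal.ofReal_pow (by positivity)] at h
  rw [ENNReal.ofReal_add (by positivity) (by positivity), ENNReal.ofReal_mul (by positivity),
    ENNReal.ofReal_mul (by positivity)]
  exact h.trans (by gcongr)

lemma summable_inner_sq {C : H →L[ℂ] H} (hC : hsSq C ≠ ∞) :
    Summable fun p : basisIndex H × basisIndex H => ‖⟪basis H p.2, C (basis H p.1)⟫_ℂ‖ ^ 2 := by
  have h : ∑' p : basisIndex H × basisIndex H, ‖⟪basis H p.2, C (basis H p.1)⟫_ℂ‖ₑ ^ 2 ≠ ∞ := by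
    rw [ENNReal.tsum_prod']
    simp_rw [← enorm_sq_eq_tsum]
    exact hC
  refine (ENNReal.summable_toReal h).congr fun p => ?_
  rw [ENNReal.toReal_pow, toReal_enorm]

lemma summable_norm_sq {C : H →L[ℂ] H} (hC : hsSq C ≠ ∞) :
    Summable fun i => ‖C (basis H i)‖ ^ 2 := by
  refine (ENNReal.summable_toReal hC).congr fun i => ?_
  rw [ENNReal.toReal_pow, toReal_enorm]

/-- Cyclicity of the trace for two Hilbert--Schmidt operators. -/
lemma hasSum_inner_swap {A B : H →L[ℂ] H} (hA : hsSq A ≠ ∞) (hB : hsSq B ≠ ∞) :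
    HasSum (fun i => ⟪basis H i, (B * A) (basis H i)⟫_ℂ)
      (∑' i, ⟪basis H i, (A * B) (basis H i)⟫_ℂ) := by
  set f : basisIndex H × basisIndex H → ℂ := fun p =>
    ⟪basis H p.1, A (basis H p.2)⟫_ℂ * ⟪basis H p.2, B (basis H p.1)⟫_ℂ with hf
  have hexp : ∀ (X Y : H →L[ℂ] H) (b : H), HasSum
      (fun j => ⟪b, X (basis H j)⟫_ℂ * ⟪basis H j, Y b⟫_ℂ) ⟪b, (X * Y) b⟫_ℂ := by
    intro X Y b
    have h := (basis H).hasSum_inner_mul_inner (star X b) (Y b)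
    have h1 : ∀ z, ⟪star X b, z⟫_ℂ = ⟪b, X z⟫_ℂ := fun z => by
      rw [ContinuousLinearMap.star_eq_adjoint, ContinuousLinearMap.adjoint_inner_left]
    simp only [h1] at h
    exact h
  -- Absolute summability of the double family, again from `2ab ≤ a² + b²`, is what licenses
  -- exchanging the two sums.
  have hs : Summable f := by
    have hA' := summable_inner_sq hA
    rw [← (Equiv.prodComm _ _).summable_iff] at hA'
    refine Summable.of_norm_bounded (hA'.add (summable_inner_sq hB)) fun p => ?_
    simp only [hf, norm_mul, Function.comp_apply, Equiv.prodComm_apply, Prod.fst_swap,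
      Prod.snd_swap]
    nlinarith [sq_nonneg (‖⟪basis H p.1, A (basis H p.2)⟫_ℂ‖
      - ‖⟪basis H p.2, B (basis H p.1)⟫_ℂ‖), sq_nonneg ‖⟪basis H p.1, A (basis H p.2)⟫_ℂ‖,
      sq_nonneg ‖⟪basis H p.2, B (basis H p.1)⟫_ℂ‖]
  have h1 := hs.hasSum.prod_fiberwise (fun i => hexp A B (basis H i))
  have h2 := ((Equiv.prodComm _ _).hasSum_iff.2 hs.hasSum).prod_fiberwise
    (g := fun j => ⟪basis H j, (B * A) (basis H j)⟫_ℂ) (fun j => by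
      simp only [hf, Function.comp_apply, Equiv.prodComm_apply, Prod.swap_prod_mk]
      simp_rw [mul_comm (⟪basis H _, A (basis H j)⟫_ℂ)]
      exact hexp B A (basis H j))
  rw [h1.tsum_eq]
  exact h2

end HilbertSchmidt

/-! ### The functionals `σ ↦ tr (σ x)` and positive trace class operators. -/

namespace TraceClass

/-- The functional `σ ↦ tr (σ x)` is bounded for the trace norm. -/
def traceMul (x : H →L[ℂ] H) : TraceClass H →L[ℂ] ℂ :=
  -- The constant is `tsum_inner_le` with left factor `U`, `‖U‖ ≤ 1`, and right factor `x`. It is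
  -- not sharp; only boundedness matters.
  (pairing H x).mkContinuous ((1 + ‖x‖ ^ 2) / 2) fun σ => by
    change ‖∑' i, ⟪basis H i, (toOp σ * x) (basis H i)⟫_ℂ‖ ≤ _
    obtain ⟨U, C, hU, hC, hA, -, -, hN⟩ := exists_factor (toOp σ)
    have h := tsum_inner_le U C x hC
    rw [← hA, ← hN, eTraceNorm_toOp] at h
    have h1 : 2 * ∑' i, ‖⟪basis H i, (toOp σ * x) (basis H i)⟫_ℂ‖ₑ ≤
        ENNReal.ofReal ((1 + ‖x‖ ^ 2) * ‖σ‖) := by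
      refine h.trans ?_
      rw [ENNReal.ofReal_mul (by positivity), ENNReal.ofReal_add (by positivity) (by positivity),
        ENNReal.ofReal_pow (norm_nonneg _), ofReal_norm x, ENNReal.ofReal_one]
      gcongr
      exact pow_le_one₀ zero_le hU
    have hne : ∑' i, ‖⟪basis H i, (toOp σ * x) (basis H i)⟫_ℂ‖ₑ ≠ ∞ := by
      intro h2
      rw [h2, ENNReal.mul_top (by norm_num)] at h1
      exact absurd (top_le_iff.1 h1) ENNReal.ofReal_ne_top
    have h2 := ENNReal.toReal_mono ENNReal.ofReal_ne_top h1
    rw [ENNReal.toReal_mul, ENNReal.toReal_ofReal (by positivity),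
      ENNReal.tsum_toReal_eq (fun _ => enorm_ne_top)] at h2
    simp only [toReal_enorm, ENNReal.toReal_ofNat] at h2
    have h3 := norm_tsum_le_tsum_norm
      ((ENNReal.summable_toReal hne).congr fun i => toReal_enorm _)
    linarith

lemma traceMul_apply (x : H →L[ℂ] H) (σ : TraceClass H) : traceMul x σ = (σ.mulOp x).trace := rfl

lemma traceMul_eq_tsum (x : H →L[ℂ] H) (σ : TraceClass H) :
    traceMul x σ = ∑' i, ⟪basis H i, (toOp σ * x) (basis H i)⟫_ℂ := rfl

lemma traceMul_one (σ : TraceClass H) : traceMul 1 σ = σ.trace := by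
  rw [traceMul_apply, mulOp]
  congr 1

lemma traceMul_sub (x y : H →L[ℂ] H) (σ : TraceClass H) :
    traceMul (x - y) σ = traceMul x σ - traceMul y σ :=
  LinearMap.congr_fun ((pairing H).map_sub x y) σ

lemma traceMul_rankOne (σ : TraceClass H) (u v : H) :
    traceMul (InnerProductSpace.rankOne ℂ u v) σ = ⟪v, σ.toOp u⟫_ℂ := by
  change ∑' i, ⟪basis H i, σ.toOp ((InnerProductSpace.rankOne ℂ u v) (basis H i))⟫_ℂ = _
  rw [← (basis H).tsum_inner_mul_inner v (σ.toOp u)]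
  refine tsum_congr fun i => ?_
  rw [InnerProductSpace.rankOne_apply, map_smul, inner_smul_right]

lemma ext_traceMul {σ τ : TraceClass H} (h : ∀ x, traceMul x σ = traceMul x τ) : σ = τ :=
  eq_of_trace_mulOp_eq h

lemma continuous_toOp : Continuous (toOp : TraceClass H → (H →L[ℂ] H)) :=
  (toOp.mkContinuous 1 fun σ => by rw [one_mul]; exact norm_toOp_le σ).continuous

/-- A positive trace class operator is the square of a self-adjoint Hilbert--Schmidt operator. -/
lemma exists_sqrt {σ : TraceClass H} (hσ : 0 ≤ σ.toOp) :
    ∃ C : H →L[ℂ] H, star C = C ∧ σ.toOp = C * C ∧ hsSq C = ENNReal.ofReal ‖σ‖ := by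
  obtain ⟨-, C, -, hC, -, -, hab, hN⟩ := exists_factor σ.toOp
  refine ⟨C, hC, ?_, ?_⟩
  · rw [← hab, CFC.abs_of_nonneg _ hσ]
  · rw [← hN, eTraceNorm_toOp]

/-- Cyclicity: `tr (C C x) = tr (C x C)`. In this form the trace is visibly monotone in `x`, which
the positivity and domination arguments rely on. -/
lemma hasSum_inner_sqrt {σ : TraceClass H} {C : H →L[ℂ] H} (hC : star C = C)
    (hσ : σ.toOp = C * C) (hfin : hsSq C ≠ ∞) (x : H →L[ℂ] H) :
    HasSum (fun i => ⟪C (basis H i), x (C (basis H i))⟫_ℂ) (traceMul x σ) := by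
  have h := hasSum_inner_swap (A := C) (B := C * x) hfin
    (ne_top_of_le_ne_top (by finiteness) (hsSq_mul_le' x C))
  rw [← mul_assoc, ← hσ, ← traceMul_eq_tsum] at h
  convert h using 2 with i
  conv_rhs => rw [mul_assoc, ← hC, inner_star_mul, hC]
  rfl

lemma traceMul_nonneg {σ : TraceClass H} (hσ : 0 ≤ σ.toOp) {x : H →L[ℂ] H} (hx : 0 ≤ x) :
    0 ≤ traceMul x σ := by
  obtain ⟨C, hC, h1, h2⟩ := exists_sqrt hσ
  refine (hasSum_inner_sqrt hC h1 (by rw [h2]; exact ENNReal.ofReal_ne_top) x).nonneg fun i => ?_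
  exact ((ContinuousLinearMap.nonneg_iff_isPositive _).1 hx).inner_nonneg_right _

lemma norm_eq_trace {σ : TraceClass H} (hσ : 0 ≤ σ.toOp) : (‖σ‖ : ℂ) = σ.trace := by
  have hp := (ContinuousLinearMap.nonneg_iff_isPositive _).1 hσ
  change ((∑' i, (⟪basis H i, CFC.abs σ.toOp (basis H i)⟫_ℂ).re : ℝ) : ℂ)
    = ∑' i, ⟪basis H i, σ.toOp (basis H i)⟫_ℂ
  rw [CFC.abs_of_nonneg _ hσ, Complex.ofReal_tsum]
  refine tsum_congr fun i => ?_
  have := hp.inner_nonneg_right (basis H i)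
  exact (Complex.eq_re_of_ofReal_le this).symm

end TraceClass

lemma IsDensity.norm_eq_one {σ : TraceClass H} (hσ : IsDensity σ) : ‖σ‖ = 1 := by
  have := TraceClass.norm_eq_trace hσ.nonneg
  rw [hσ.trace_eq_one] at this
  exact_mod_cast this

open TraceClass Filter Topology

/-! ### Finite-dimensional compressions, tightness and compactness. -/

section Compression

/-- The orthogonal projection onto the span of the basis vectors indexed by `F`. -/
def basisProj (F : Finset (basisIndex H)) : H →L[ℂ] H :=
  ∑ i ∈ F, InnerProductSpace.rankOne ℂ (basis H i) (basis H i)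

lemma basisProj_apply (F : Finset (basisIndex H)) (x : H) :
    basisProj F x = ∑ i ∈ F, ⟪basis H i, x⟫_ℂ • basis H i := by
  simp [basisProj]

lemma star_rankOne (u v : H) :
    star (InnerProductSpace.rankOne ℂ u v) = InnerProductSpace.rankOne ℂ v u := by
  rw [ContinuousLinearMap.star_eq_adjoint, InnerProductSpace.adjoint_rankOne]

lemma star_basisProj (F : Finset (basisIndex H)) : star (basisProj F) = basisProj F := by
  simp [basisProj, star_sum, star_rankOne]

lemma basisProj_basis {F : Finset (basisIndex H)} {i : basisIndex H} (hi : i ∈ F) :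
    basisProj F (basis H i) = basis H i := by
  classical
  rw [basisProj_apply]
  simp_rw [orthonormal_iff_ite.1 (basis H).orthonormal]
  simp [hi]

lemma basisProj_mul_self (F : Finset (basisIndex H)) :
    basisProj F * basisProj F = basisProj F := by
  ext x
  rw [mul_apply_eq_comp, basisProj_apply F x, map_sum]
  refine Finset.sum_congr rfl fun i hi => ?_
  rw [map_smul, basisProj_basis hi]

lemma star_one_sub_basisProj (F : Finset (basisIndex H)) :
    star (1 - basisProj F) = 1 - basisProj F := by
  rw [star_sub, star_one, star_basisProj]

lemma one_sub_basisProj_mul_self (F : Finset (basisIndex H)) :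
    (1 - basisProj F) * (1 - basisProj F) = 1 - basisProj F := by
  rw [sub_mul, mul_sub, mul_sub, basisProj_mul_self]
  simp

lemma basisProj_nonneg (F : Finset (basisIndex H)) : 0 ≤ basisProj F := by
  have := star_mul_self_nonneg (basisProj F)
  rwa [star_basisProj, basisProj_mul_self] at this

lemma one_sub_basisProj_nonneg (F : Finset (basisIndex H)) : 0 ≤ 1 - basisProj F := by
  have := star_mul_self_nonneg (1 - basisProj F)
  rwa [star_one_sub_basisProj, one_sub_basisProj_mul_self] at this

lemma hsSq_rankOne_ne_top (u v : H) : hsSq (InnerProductSpace.rankOne ℂ u v) ≠ ∞ := by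
  have : hsSq (InnerProductSpace.rankOne ℂ u v) = ‖v‖ₑ ^ 2 * ‖u‖ₑ ^ 2 := by
    rw [hsSq, enorm_sq_eq_tsum v, ← ENNReal.tsum_mul_right]
    refine tsum_congr fun i => ?_
    rw [InnerProductSpace.rankOne_apply, enorm_smul, mul_pow, ← inner_conj_symm, RCLike.enorm_conj]
  rw [this]
  finiteness

/-- A matrix unit is a product of two rank-one, hence Hilbert–Schmidt, operators. -/
lemma isTraceClass_matrixUnit (i j : basisIndex H) :
    IsTraceClass (InnerProductSpace.rankOne ℂ (basis H i) (basis H j)) := by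
  have h : InnerProductSpace.rankOne ℂ (basis H i) (basis H j)
      = InnerProductSpace.rankOne ℂ (basis H i) (basis H i)
        * InnerProductSpace.rankOne ℂ (basis H i) (basis H j) := by
    ext x
    have : ⟪(basis H i : H), basis H i⟫_ℂ = 1 := by
      classical
      simpa using orthonormal_iff_ite.1 (basis H).orthonormal i i
    simp [InnerProductSpace.rankOne_apply, this, -inner_self_eq_norm_sq_to_K]
  rw [isTraceClass_iff, h]
  intro h1
  have h2 := two_mul_eTraceNorm_mul_le (InnerProductSpace.rankOne ℂ (basis H i) (basis H i))
    (InnerProductSpace.rankOne ℂ (basis H i) (basis H j))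
  rw [h1, ENNReal.mul_top (by norm_num), top_le_iff, ENNReal.add_eq_top] at h2
  exact h2.elim (hsSq_rankOne_ne_top _ _) (hsSq_rankOne_ne_top _ _)

/-- The operator with matrix `c` on the span of the basis vectors indexed by `F`, zero elsewhere. -/
def ofMatrix (F : Finset (basisIndex H)) (c : F × F → ℂ) : TraceClass H :=
  ∑ p, c p • TraceClass.mk _ (isTraceClass_matrixUnit p.1.1 p.2.1)

lemma continuous_ofMatrix (F : Finset (basisIndex H)) : Continuous (ofMatrix F) := by
  unfold ofMatrix
  fun_prop

/-- The matrix entries of `σ` indexed by `F`. -/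
def entries (F : Finset (basisIndex H)) (σ : TraceClass H) (p : F × F) : ℂ :=
  ⟪(basis H p.1.1 : H), σ.toOp (basis H p.2.1)⟫_ℂ

/-- This exhibits the compression as the image of a finite matrix under the continuous map `ofMatrix
F`, so finite-dimensional compactness and entrywise limits apply. -/
lemma toOp_ofMatrix_entries (F : Finset (basisIndex H)) (σ : TraceClass H) :
    (ofMatrix F (entries F σ)).toOp = basisProj F * σ.toOp * basisProj F := by
  ext x
  have h1 : (basisProj F * σ.toOp * basisProj F) x = ∑ i ∈ F, ∑ j ∈ F,
      (⟪basis H j, x⟫_ℂ * ⟪(basis H i : H), σ.toOp (basis H j)⟫_ℂ) • (basis H i : H) := by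
    change basisProj F (σ.toOp (basisProj F x)) = _
    rw [basisProj_apply F x, map_sum, basisProj_apply]
    refine Finset.sum_congr rfl fun i _ => ?_
    rw [inner_sum, Finset.sum_smul]
    refine Finset.sum_congr rfl fun j _ => ?_
    rw [map_smul, inner_smul_right]
  rw [h1, ofMatrix, map_sum, sum_apply, Fintype.sum_prod_type,
    ← Finset.sum_coe_sort F]
  refine Finset.sum_congr rfl fun i _ => ?_
  rw [← Finset.sum_coe_sort F]
  refine Finset.sum_congr rfl fun j _ => ?_
  rw [map_smul, toOp_mk, smul_apply, InnerProductSpace.rankOne_apply, smul_smul, entries, mul_comm]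

lemma hsSq_proj_mul {σ : TraceClass H} {C E : H →L[ℂ] H} (hC : star C = C)
    (hσ : σ.toOp = C * C) (hfin : hsSq C ≠ ∞) (hE : star E = E) (hEE : E * E = E) :
    hsSq (E * C) = ENNReal.ofReal (traceMul E σ).re := by
  have h := Complex.hasSum_re (hasSum_inner_sqrt hC hσ hfin E)
  have h1 : ∀ i, (⟪C (basis H i), E (C (basis H i))⟫_ℂ).re = ‖(E * C) (basis H i)‖ ^ 2 := by
    intro i
    have h2 := inner_star_mul E E (C (basis H i))
    rw [hE, hEE, inner_self_eq_norm_sq_to_K] at h2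
    rw [h2]
    norm_cast
  simp only [h1] at h
  rw [← h.tsum_eq, ENNReal.ofReal_tsum_of_nonneg (fun _ => by positivity) h.summable, hsSq]
  refine tsum_congr fun i => ?_
  rw [ENNReal.ofReal_pow (norm_nonneg _), ofReal_norm]

/-- A density whose mass outside `F` is small is close to its compression to `F`. -/
lemma norm_sub_ofMatrix_entries_le {σ : TraceClass H} (hσ : IsDensity σ)
    (F : Finset (basisIndex H)) {c : ℝ} (hc : 0 < c)
    (h : (traceMul (1 - basisProj F) σ).re ≤ c ^ 4) :
    ‖σ - ofMatrix F (entries F σ)‖ ≤ 2 * c ^ 2 := by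
  obtain ⟨C, hC, h1, h2⟩ := exists_sqrt hσ.nonneg
  rw [hσ.norm_eq_one] at h2
  have hfin : hsSq C ≠ ∞ := by rw [h2]; exact ENNReal.ofReal_ne_top
  set P := basisProj F with hP
  have hQ : hsSq ((1 - P) * C) ≤ ENNReal.ofReal (c ^ 4) := by
    rw [hsSq_proj_mul hC h1 hfin (star_one_sub_basisProj F) (one_sub_basisProj_mul_self F)]
    exact ENNReal.ofReal_le_ofReal h
  have hQ' : hsSq (C * (1 - P)) ≤ ENNReal.ofReal (c ^ 4) := by
    rwa [← hsSq_star, star_mul, hC, hP, star_one_sub_basisProj]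
  have hPC : hsSq (C * P) ≤ ENNReal.ofReal 1 := by
    rw [← hsSq_star, star_mul, hC, hP, star_basisProj,
      hsSq_proj_mul hC h1 hfin (star_basisProj F) (basisProj_mul_self F)]
    refine ENNReal.ofReal_le_ofReal ?_
    have h3 := (Complex.le_def.1 (traceMul_nonneg hσ.nonneg (one_sub_basisProj_nonneg F))).1
    rw [traceMul_sub, traceMul_one, hσ.trace_eq_one] at h3
    simpa using h3
  -- The weights `c` and `c⁻¹` balance the bounds `1` and `c ^ 4`: each product contributes `c² +
  -- c⁻² c⁴ = 2c²`.
  have e1 := eTraceNorm_mul_le_of_hsSq_le hc zero_le_one (by positivity) h2.le hQ'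
  have e2 := eTraceNorm_mul_le_of_hsSq_le (inv_pos.2 hc) (by positivity) zero_le_one hQ hPC
  -- With `σ = C C`, the splitting is `σ - PσP = σ(1 - P) + (1 - P)σP`; each term has a
  -- Hilbert–Schmidt factor that is small.
  have e3 : eTraceNorm (σ - ofMatrix F (entries F σ)).toOp
      ≤ eTraceNorm (C * (C * (1 - P))) + eTraceNorm ((1 - P) * C * (C * P)) := by
    rw [map_sub, toOp_ofMatrix_entries, h1, ← hP]
    refine le_trans (le_of_eq ?_) (eTraceNorm_add_le _ _)
    congr 1
    noncomm_ring
  have e4 : 2 * eTraceNorm (σ - ofMatrix F (entries F σ)).toOp ≤ ENNReal.ofReal (4 * c ^ 2) := by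
    calc _ ≤ 2 * eTraceNorm (C * (C * (1 - P))) + 2 * eTraceNorm ((1 - P) * C * (C * P)) := by
          rw [← mul_add]; gcongr
      _ ≤ _ := add_le_add e1 e2
      _ = _ := by
          rw [← ENNReal.ofReal_add (by positivity) (by positivity)]
          congr 1
          field_simp
          ring
  rw [eTraceNorm_toOp, ← ENNReal.ofReal_ofNat 2, ← ENNReal.ofReal_mul (by norm_num),
    ENNReal.ofReal_le_ofReal_iff (by positivity)] at e4
  linarith

lemma traceMul_basisProj (F : Finset (basisIndex H)) (σ : TraceClass H) :
    traceMul (basisProj F) σ = ∑ i ∈ F, ⟪(basis H i : H), σ.toOp (basis H i)⟫_ℂ := by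
  have h : traceMul (basisProj F) σ = ∑ i ∈ F,
      traceMul (InnerProductSpace.rankOne ℂ (basis H i) (basis H i)) σ :=
    (LinearMap.congr_fun (map_sum (pairing H) _ F) σ).trans (LinearMap.sum_apply _ _ _)
  rw [h]
  exact Finset.sum_congr rfl fun i _ => traceMul_rankOne σ _ _

lemma tendsto_traceMul_one_sub_basisProj (σ : TraceClass H) :
    Tendsto (fun F => (traceMul (1 - basisProj F) σ).re) atTop (𝓝 0) := by
  have h : Tendsto (fun F => traceMul (basisProj F) σ) atTop (𝓝 σ.trace) := by
    simp_rw [traceMul_basisProj]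
    exact σ.isTraceClass.summable_inner.hasSum
  have h2 : Tendsto (fun F => traceMul (1 - basisProj F) σ) atTop (𝓝 0) := by
    simp_rw [traceMul_sub, traceMul_one]
    simpa using h.const_sub σ.trace
  exact (Complex.continuous_re.tendsto 0).comp h2

/-- Entrywise convergence of densities to a density implies convergence in trace norm. -/
lemma tendsto_of_tendsto_entries {ι : Type*} {l : Filter ι} {u : ι → TraceClass H}
    {σ : TraceClass H} (hu : ∀ n, IsDensity (u n)) (hσ : IsDensity σ)
    (h : ∀ i j, Tendsto (fun n => ⟪(basis H i : H), (u n).toOp (basis H j)⟫_ℂ) l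
      (𝓝 ⟪(basis H i : H), σ.toOp (basis H j)⟫_ℂ)) : Tendsto u l (𝓝 σ) := by
  rw [Metric.tendsto_nhds]
  intro ε hε
  -- Budget: `2c²` for each of two compression errors, `c²` between the compressions.
  obtain ⟨c, hc, hcε⟩ : ∃ c : ℝ, 0 < c ∧ 5 * c ^ 2 = ε :=
    ⟨√(ε / 5), by positivity, by rw [Real.sq_sqrt (by positivity)]; ring⟩
  obtain ⟨F, hF⟩ := ((tendsto_order.1 (tendsto_traceMul_one_sub_basisProj σ)).2 (c ^ 4)
    (by positivity)).exists
  -- All traces equal one, so the mass outside `F` is one minus a finite sum of diagonal entries and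
  -- converges with them: no mass is lost in the limit.
  have h1 : Tendsto (fun n => (traceMul (1 - basisProj F) (u n)).re) l
      (𝓝 (traceMul (1 - basisProj F) σ).re) := by
    refine (Complex.continuous_re.tendsto _).comp ?_
    simp_rw [traceMul_sub, traceMul_one, (hu _).trace_eq_one, hσ.trace_eq_one, traceMul_basisProj]
    exact (tendsto_finsetSum _ fun i _ => h i i).const_sub 1
  have h2 : Tendsto (fun n => ofMatrix F (entries F (u n))) l (𝓝 (ofMatrix F (entries F σ))) :=
    ((continuous_ofMatrix F).tendsto _).comp (tendsto_pi_nhds.2 fun p => h _ _)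
  filter_upwards [(tendsto_order.1 h1).2 _ hF, Metric.tendsto_nhds.1 h2 (c ^ 2) (by positivity)]
    with n hn1 hn2
  have e1 := norm_sub_ofMatrix_entries_le (hu n) F hc hn1.le
  have e2 := norm_sub_ofMatrix_entries_le hσ F hc hF.le
  rw [← dist_eq_norm] at e1 e2
  have e3 := dist_triangle4 (u n) (ofMatrix F (entries F (u n))) (ofMatrix F (entries F σ)) σ
  rw [dist_comm (ofMatrix F (entries F σ)) σ] at e3
  linarith

/-- A tight set of densities is totally bounded for the trace norm. -/
lemma totallyBounded_of_tight {S : Set (TraceClass H)} (hS : ∀ σ ∈ S, IsDensity σ)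
    (htight : ∀ ε > 0, ∃ F : Finset (basisIndex H), ∀ σ ∈ S,
      (traceMul (1 - basisProj F) σ).re ≤ ε) : TotallyBounded S := by
  rw [Metric.totallyBounded_iff]
  intro ε hε
  obtain ⟨c, hc, hcε⟩ : ∃ c : ℝ, 0 < c ∧ 3 * c ^ 2 = ε :=
    ⟨√(ε / 3), by positivity, by rw [Real.sq_sqrt (by positivity)]; ring⟩
  obtain ⟨F, hF⟩ := htight (c ^ 4) (by positivity)
  have hK : TotallyBounded (ofMatrix F '' Metric.closedBall 0 1) :=
    ((isCompact_closedBall _ _).image (continuous_ofMatrix F)).totallyBounded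
  obtain ⟨t, ht, hcov⟩ := Metric.totallyBounded_iff.1 hK (c ^ 2) (by positivity)
  refine ⟨t, ht, fun σ hσ => ?_⟩
  -- Entries are at most one in modulus, as the operator norm is dominated by the trace norm.
  have hmem : ofMatrix F (entries F σ) ∈ ofMatrix F '' Metric.closedBall 0 1 := by
    refine ⟨_, ?_, rfl⟩
    rw [mem_closedBall_zero_iff, pi_norm_le_iff_of_nonneg zero_le_one]
    intro p
    refine (norm_inner_le_norm _ _).trans ?_
    have h1 := σ.toOp.le_opNorm (basis H p.2.1)
    have h2 := σ.norm_toOp_le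
    rw [(hS σ hσ).norm_eq_one] at h2
    rw [(basis H).orthonormal.1] at h1 ⊢
    linarith
  obtain ⟨τ, hτ, hd⟩ := Set.mem_iUnion₂.1 (hcov hmem)
  refine Set.mem_iUnion₂.2 ⟨τ, hτ, ?_⟩
  rw [Metric.mem_ball] at hd ⊢
  have e1 := norm_sub_ofMatrix_entries_le (hS σ hσ) F hc (hF σ hσ)
  rw [← dist_eq_norm] at e1
  have := dist_triangle σ (ofMatrix F (entries F σ)) τ
  linarith

end Compression

/-! ### Absolute continuity with respect to a faithful density. -/

section AbsoluteContinuity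

/-- The positive operator `R x R` has trace norm `tr (ρ x)`, which bounds its operator norm. -/
lemma re_inner_le_mul_re_traceMul {ρ : TraceClass H} {R : H →L[ℂ] H} (hR : star R = R)
    (hρ : ρ.toOp = R * R) (hfin : hsSq R ≠ ∞) {x : H →L[ℂ] H} (hx : 0 ≤ x) (ψ : H) :
    (⟪R ψ, x (R ψ)⟫_ℂ).re ≤ ‖ψ‖ ^ 2 * (traceMul x ρ).re := by
  have hy : 0 ≤ star R * x * R := star_left_conjugate_nonneg hx R
  have hin : ∀ v, ⟪v, (star R * x * R) v⟫_ℂ = ⟪R v, x (R v)⟫_ℂ := fun v => by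
    rw [mul_assoc, inner_star_mul]
    rfl
  have hs := Complex.hasSum_re (hasSum_inner_sqrt hR hρ hfin x)
  have hpos : ∀ v, 0 ≤ (⟪v, x v⟫_ℂ).re :=
    ((ContinuousLinearMap.nonneg_iff_isPositive _).1 hx).re_inner_nonneg_right
  have htr : eTraceNorm (star R * x * R) = ENNReal.ofReal (traceMul x ρ).re := by
    rw [eTraceNorm, CFC.abs_of_nonneg _ hy, ← hs.tsum_eq,
      ENNReal.ofReal_tsum_of_nonneg (fun _ => hpos _) hs.summable]
    simp_rw [hin]
  have hle := enorm_le_eTraceNorm (star R * x * R)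
  have hρ0 : 0 ≤ ρ.toOp := by
    have := star_mul_self_nonneg R
    rwa [hR, ← hρ] at this
  rw [htr, ← ofReal_norm, ENNReal.ofReal_le_ofReal_iff
    (Complex.le_def.1 (traceMul_nonneg hρ0 hx)).1] at hle
  calc (⟪R ψ, x (R ψ)⟫_ℂ).re = (⟪ψ, (star R * x * R) ψ⟫_ℂ).re := by rw [hin]
    _ ≤ ‖ψ‖ * ‖(star R * x * R) ψ‖ := (Complex.re_le_norm _).trans (norm_inner_le_norm _ _)
    _ ≤ ‖ψ‖ * ((traceMul x ρ).re * ‖ψ‖) := by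
        gcongr
        exact ((star R * x * R).le_opNorm ψ).trans (by gcongr)
    _ = _ := by ring

lemma re_inner_le_norm_sq {x : H →L[ℂ] H} (hx : x ≤ 1) (v : H) : (⟪v, x v⟫_ℂ).re ≤ ‖v‖ ^ 2 := by
  have h := ((ContinuousLinearMap.nonneg_iff_isPositive _).1
    (sub_nonneg.2 hx)).re_inner_nonneg_right v
  have h1 : ⟪v, (1 : H →L[ℂ] H) v⟫_ℂ = (‖v‖ : ℂ) ^ 2 := inner_self_eq_norm_sq_to_K v
  have h2 : ((‖v‖ : ℂ) ^ 2).re = ‖v‖ ^ 2 := by norm_cast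
  rw [sub_apply, inner_sub_right, h1, RCLike.re_to_complex, Complex.sub_re, h2] at h
  exact sub_nonneg.1 h

/-- Parallelogram law for the form of `x`, dropping the nonnegative value at `a - b`. -/
lemma re_inner_add_le {K : Type*} [NormedAddCommGroup K] [InnerProductSpace ℂ K] {x : K →L[ℂ] K}
    (hx : 0 ≤ x) (a b : K) :
    (⟪a + b, x (a + b)⟫_ℂ).re ≤ 2 * (⟪a, x a⟫_ℂ).re + 2 * (⟪b, x b⟫_ℂ).re := by
  have h : 0 ≤ (⟪a - b, x (a - b)⟫_ℂ).re :=
    ((ContinuousLinearMap.nonneg_iff_isPositive _).1 hx).re_inner_nonneg_right (a - b)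
  simp only [map_add, map_sub, inner_add_left, inner_add_right, inner_sub_left, inner_sub_right,
    Complex.add_re, Complex.sub_re] at h ⊢
  linarith

/-- Faithfulness approximates `φ` by `ρ w = R (R w)`. The error is controlled by `x ≤ 1`, the main
part by `tr (ρ x)`. -/
lemma exists_re_inner_le {ρ : TraceClass H} (hρ : 0 ≤ ρ.toOp) (hfaith : IsFaithful ρ) (φ : H)
    {δ : ℝ} (hδ : 0 < δ) : ∃ c : ℝ, ∀ x : H →L[ℂ] H, 0 ≤ x → x ≤ 1 →
      (⟪φ, x φ⟫_ℂ).re ≤ δ + c * (traceMul x ρ).re := by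
  obtain ⟨R, hR, h1, h2⟩ := exists_sqrt hρ
  have hmem : φ ∈ closure (Set.range ρ.toOp) := hfaith ▸ Set.mem_univ φ
  obtain ⟨_, ⟨w, rfl⟩, hw⟩ := Metric.mem_closure_iff.1 hmem (√(δ / 2)) (by positivity)
  refine ⟨2 * ‖R w‖ ^ 2, fun x hx hx1 => ?_⟩
  have e0 : ρ.toOp w = R (R w) := by rw [h1]; rfl
  rw [e0, dist_eq_norm] at hw
  have e1 := re_inner_add_le hx (φ - R (R w)) (R (R w))
  rw [sub_add_cancel] at e1
  have e2 := re_inner_le_norm_sq hx1 (φ - R (R w))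
  have e3 := re_inner_le_mul_re_traceMul hR h1 (by rw [h2]; exact ENNReal.ofReal_ne_top) hx (R w)
  have e4 : ‖φ - R (R w)‖ ^ 2 ≤ δ / 2 := by
    rw [← Real.sq_sqrt (show 0 ≤ δ / 2 by positivity)]
    gcongr
  linarith

/-- Every positive trace class operator is absolutely continuous with respect to a faithful one. -/
lemma exists_re_traceMul_le {ρ η : TraceClass H} (hρ : 0 ≤ ρ.toOp) (hfaith : IsFaithful ρ)
    (hη : 0 ≤ η.toOp) {ε : ℝ} (hε : 0 < ε) : ∃ c : ℝ, ∀ x : H →L[ℂ] H, 0 ≤ x → x ≤ 1 →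
      (traceMul x η).re ≤ ε + c * (traceMul x ρ).re := by
  obtain ⟨C, hC, h1, h2⟩ := exists_sqrt hη
  have hfin : hsSq C ≠ ∞ := by rw [h2]; exact ENNReal.ofReal_ne_top
  have hsum := summable_norm_sq hfin
  -- Outside `F` the bound `x ≤ 1` costs at most `ε / 2`; inside, finitely many vectors share the
  -- other half. The `+ 1` below covers empty `F`.
  obtain ⟨F, hF⟩ := ((tendsto_order.1 (tendsto_tsum_compl_atTop_zero
    fun i => ‖C (basis H i)‖ ^ 2)).2 (ε / 2) (by positivity)).exists
  have hδ : 0 < ε / 2 / (F.card + 1) := by positivity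
  choose c hc using fun i => exists_re_inner_le hρ hfaith (C (basis H i)) hδ
  refine ⟨∑ i ∈ F, c i, fun x hx hx1 => ?_⟩
  have hs := Complex.hasSum_re (hasSum_inner_sqrt hC h1 hfin x)
  rw [← hs.tsum_eq, ← hs.summable.sum_add_tsum_subtype_compl F]
  have e1 : ∑ i ∈ F, (⟪C (basis H i), x (C (basis H i))⟫_ℂ).re
      ≤ ε / 2 + (∑ i ∈ F, c i) * (traceMul x ρ).re := by
    refine (Finset.sum_le_sum fun i _ => hc i x hx hx1).trans ?_
    rw [Finset.sum_add_distrib, Finset.sum_const, nsmul_eq_mul, ← Finset.sum_mul]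
    gcongr
    rw [mul_div_assoc', div_le_iff₀ (by positivity)]
    nlinarith
  have e2 : ∑' i : {i // i ∉ F}, (⟪C (basis H i.1), x (C (basis H i.1))⟫_ℂ).re
      ≤ ∑' i : {i // i ∉ F}, ‖C (basis H i.1)‖ ^ 2 :=
    (hs.summable.subtype _).tsum_le_tsum (fun i => re_inner_le_norm_sq hx1 _) (hsum.subtype _)
  linarith

end AbsoluteContinuity

/-! ### Closedness and convexity of the densities; stability of faithfulness. -/

section Densities

lemma isClosed_setOf_isDensity : IsClosed {σ : TraceClass H | IsDensity σ} := by
  have : {σ : TraceClass H | IsDensity σ} = {σ | 0 ≤ σ.toOp} ∩ {σ | traceMul 1 σ = 1} := by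
    ext σ
    simp only [Set.mem_ofPred_eq, Set.mem_inter_iff, traceMul_one]
    exact ⟨fun h => ⟨h.nonneg, h.trace_eq_one⟩, fun h => ⟨h.1, h.2⟩⟩
  rw [this]
  exact (isClosed_Ici.preimage continuous_toOp).inter
    (isClosed_eq (traceMul 1).continuous continuous_const)

lemma toOp_real_smul (a : ℝ) (σ : TraceClass H) : (a • σ).toOp = a • σ.toOp :=
  toOp.map_smul (a : ℂ) σ

lemma traceMul_real_smul (x : H →L[ℂ] H) (a : ℝ) (σ : TraceClass H) :
    traceMul x (a • σ) = a * traceMul x σ :=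
  (traceMul x).map_smul (a : ℂ) σ

lemma convex_setOf_isDensity : Convex ℝ {σ : TraceClass H | IsDensity σ} := by
  intro σ hσ τ hτ a b ha hb hab
  refine ⟨?_, ?_⟩
  · rw [map_add, toOp_real_smul, toOp_real_smul]
    exact add_nonneg (smul_nonneg ha hσ.nonneg) (smul_nonneg hb hτ.nonneg)
  · rw [← traceMul_one, map_add, traceMul_real_smul, traceMul_real_smul, traceMul_one,
      traceMul_one, hσ.trace_eq_one, hτ.trace_eq_one, mul_one, mul_one]
    exact_mod_cast hab

lemma convex_setOf_re_traceMul_le (x : H →L[ℂ] H) (r : ℝ) :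
    Convex ℝ {σ : TraceClass H | (traceMul x σ).re ≤ r} := by
  refine convex_halfSpace_le ⟨fun σ τ => ?_, fun a σ => ?_⟩ r
  · rw [map_add, Complex.add_re]
  · rw [traceMul_real_smul, Complex.re_ofReal_mul, smul_eq_mul]

/-- A positive trace class operator dominating a positive multiple of a faithful one is faithful. -/
lemma IsFaithful.of_smul_add {ρ σ τ : TraceClass H} (hρ : 0 ≤ ρ.toOp) (hfaith : IsFaithful ρ)
    (hσ : 0 ≤ σ.toOp) {a : ℝ} (ha : 0 < a) (hτ : τ.toOp = a • ρ.toOp + a • σ.toOp) :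
    IsFaithful τ := by
  have hρp := (ContinuousLinearMap.nonneg_iff_isPositive _).1 hρ
  have hσp := (ContinuousLinearMap.nonneg_iff_isPositive _).1 hσ
  obtain ⟨R, hR, h1, -⟩ := exists_sqrt hρ
  have hcl : (LinearMap.range τ.toOp.toLinearMap).topologicalClosure = ⊤ := by
    -- If `v` is orthogonal to the range of `τ`, then `⟪τ v, v⟫ = 0` forces `⟪ρ v, v⟫ = 0`, so `R v
    -- = 0` and `v` is orthogonal to the dense range of `ρ`.
    rw [Submodule.topologicalClosure_eq_top_iff, Submodule.eq_bot_iff]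
    intro v hv
    have hv1 : ⟪τ.toOp v, v⟫_ℂ = 0 := (Submodule.mem_orthogonal _ _).1 hv _ ⟨v, rfl⟩
    have hv2 : (⟪ρ.toOp v, v⟫_ℂ).re = 0 := by
      have h2 : 0 ≤ (⟪ρ.toOp v, v⟫_ℂ).re := hρp.re_inner_nonneg_left v
      have h3 : 0 ≤ (⟪σ.toOp v, v⟫_ℂ).re := hσp.re_inner_nonneg_left v
      have h4 := congrArg Complex.re hv1
      rw [hτ, add_apply, smul_apply, smul_apply, ← Complex.coe_smul, ← Complex.coe_smul,
        inner_add_left, inner_smul_left, inner_smul_left, Complex.conj_ofReal, Complex.add_re,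
        Complex.re_ofReal_mul, Complex.re_ofReal_mul, Complex.zero_re] at h4
      nlinarith [mul_nonneg ha.le h2, mul_nonneg ha.le h3]
    have hRv : R v = 0 := by
      have h5 := inner_star_mul R R v
      rw [hR, ← h1, inner_self_eq_norm_sq_to_K] at h5
      have h6 : (⟪v, ρ.toOp v⟫_ℂ).re = ‖R v‖ ^ 2 := by rw [h5]; norm_cast
      rw [← inner_conj_symm, Complex.conj_re, hv2] at h6
      exact norm_eq_zero.1 (pow_eq_zero_iff two_ne_zero |>.1 h6.symm)
    have horth : ∀ w, ⟪ρ.toOp w, v⟫_ℂ = 0 := by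
      intro w
      rw [h1, ← inner_conj_symm]
      have : ⟪v, (R * R) w⟫_ℂ = ⟪R v, R w⟫_ℂ := by
        nth_rewrite 1 [← hR]
        rw [ContinuousLinearMap.star_eq_adjoint]
        exact ContinuousLinearMap.adjoint_inner_right R v (R w)
      rw [this, hRv, inner_zero_left, map_zero]
    have hd : Dense (Set.range ρ.toOp) := dense_iff_closure_eq.2 hfaith
    have hz : ∀ z, ⟪z, v⟫_ℂ = 0 := fun z => by
      refine hd.induction (P := fun z => ⟪z, v⟫_ℂ = 0) ?_
        (isClosed_eq (by fun_prop) continuous_const) z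
      rintro _ ⟨w, rfl⟩
      exact horth w
    exact inner_self_eq_zero.1 (hz v)
  have h8 := congrArg (fun S : Submodule ℂ H => (S : Set H)) hcl
  exact h8

end Densities

/-! ### Predual orbits and their Cesàro means. -/

namespace QuantumMarkovSemigroup

variable (T : QuantumMarkovSemigroup H)

lemma traceMul_predual (t : ℝ≥0) (η : TraceClass H) (x : H →L[ℂ] H) :
    traceMul x (T.predual t η) = traceMul (T.map t x) η :=
  T.trace_predual_mulOp t η x

lemma continuous_traceMul_map (η : TraceClass H) (x : H →L[ℂ] H) :
    Continuous fun t => traceMul (T.map t x) η :=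
  (WeakBilin.eval_continuous (pairing H) η).comp (T.weakStar_continuous x)

lemma isDensity_predual {η : TraceClass H} (hη : IsDensity η) (t : ℝ≥0) :
    IsDensity (T.predual t η) where
  nonneg := by
    rw [ContinuousLinearMap.nonneg_iff_isPositive, ContinuousLinearMap.isPositive_iff_complex]
    intro v
    have h : 0 ≤ ⟪v, (T.predual t η).toOp v⟫_ℂ := by
      rw [← traceMul_rankOne, traceMul_predual]
      exact traceMul_nonneg hη.nonneg (map_nonneg (T.map t)
        ((ContinuousLinearMap.nonneg_iff_isPositive _).2
          (InnerProductSpace.isPositive_rankOne_self v)))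
    have h1 : 0 ≤ ⟪(T.predual t η).toOp v, v⟫_ℂ := by
      rw [← inner_conj_symm, Complex.le_def]
      rw [Complex.le_def] at h
      simpa only [Complex.conj_re, Complex.conj_im, Complex.zero_re, Complex.zero_im,
        neg_eq_zero, eq_comm (a := (0 : ℝ))] using h
    exact ⟨(Complex.eq_re_of_ofReal_le h1).symm, (Complex.le_def.1 h1).1⟩
  trace_eq_one := by
    rw [← traceMul_one, traceMul_predual, T.map_one, traceMul_one, hη.trace_eq_one]

/-- Orbits of densities under the predual semigroup are continuous for the trace norm. -/
lemma continuous_predual {η : TraceClass H} (hη : IsDensity η) :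
    Continuous fun t => T.predual t η := by
  refine continuous_iff_continuousAt.2 fun t => ?_
  refine tendsto_of_tendsto_entries (T.isDensity_predual hη) (T.isDensity_predual hη t)
    fun i j => ?_
  simp_rw [← traceMul_rankOne, traceMul_predual]
  exact (T.continuous_traceMul_map η _).tendsto t

lemma intervalIntegrable_predual {η : TraceClass H} (hη : IsDensity η) (a b : ℝ) :
    IntervalIntegrable (fun s : ℝ => T.predual s.toNNReal η) MeasureTheory.volume a b :=
  ((T.continuous_predual hη).comp continuous_real_toNNReal).intervalIntegrable a b

/-- The mean is an average against a probability measure, so closed convex constraints pass from the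
orbit to it. Both being a density and tightness are of this kind. -/
lemma cesaroMean_mem {η : TraceClass H} (hη : IsDensity η) {S : Set (TraceClass H)}
    (hconv : Convex ℝ S) (hcl : IsClosed S) (hS : ∀ s, T.predual s η ∈ S) {t : ℝ} (ht : 0 < t) :
    T.cesaroMean η t ∈ S := by
  have h := interval_average_eq (fun s : ℝ => T.predual s.toNNReal η) 0 t
  rw [sub_zero] at h
  rw [cesaroMean, ← h]
  refine hconv.set_average_mem hcl ?_ ?_ (Eventually.of_forall fun s => hS _) ?_
  · simpa [Set.uIoc_of_le ht.le] using ht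
  · simp [Set.uIoc_of_le ht.le]
  · exact (intervalIntegrable_iff.1 (T.intervalIntegrable_predual hη 0 t))

lemma isDensity_cesaroMean {η : TraceClass H} (hη : IsDensity η) {t : ℝ} (ht : 0 < t) :
    IsDensity (T.cesaroMean η t) :=
  T.cesaroMean_mem hη convex_setOf_isDensity isClosed_setOf_isDensity (T.isDensity_predual hη) ht

lemma traceMul_cesaroMean {η : TraceClass H} (hη : IsDensity η) (x : H →L[ℂ] H) (t : ℝ) :
    traceMul x (T.cesaroMean η t)
      = t⁻¹ • ∫ s in (0 : ℝ)..t, traceMul (T.map s.toNNReal x) η := by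
  rw [cesaroMean, traceMul_real_smul, Complex.real_smul,
    ← (traceMul x).intervalIntegral_comp_comm (T.intervalIntegrable_predual hη 0 t)]
  simp_rw [traceMul_predual]

/-- The means are asymptotically invariant. -/
lemma tendsto_traceMul_map_cesaroMean_sub {η : TraceClass H} (hη : IsDensity η)
    (r : ℝ≥0) (x : H →L[ℂ] H) :
    Tendsto (fun t => traceMul (T.map r x) (T.cesaroMean η t) - traceMul x (T.cesaroMean η t))
      atTop (𝓝 0) := by
  set f : ℝ → ℂ := fun s => traceMul (T.map s.toNNReal x) η with hf
  have hcont : Continuous f := (T.continuous_traceMul_map η x).comp continuous_real_toNNReal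
  have hint : ∀ a b, IntervalIntegrable f MeasureTheory.volume a b :=
    fun a b => hcont.intervalIntegrable a b
  have hbound : ∀ s, ‖f s‖ ≤ ‖traceMul x‖ := fun s => by
    have h1 : f s = traceMul x (T.predual s.toNNReal η) := (T.traceMul_predual _ _ _).symm
    have h2 := (traceMul x).le_opNorm (T.predual s.toNNReal η)
    rwa [(T.isDensity_predual hη _).norm_eq_one, mul_one, ← h1] at h2
  have hdiff : ∀ t > 0,
      ‖traceMul (T.map r x) (T.cesaroMean η t) - traceMul x (T.cesaroMean η t)‖
        ≤ t⁻¹ * (2 * (‖traceMul x‖ * r)) := by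
    intro t ht
    have h1 : ∫ s in (0 : ℝ)..t, traceMul (T.map s.toNNReal (T.map r x)) η
        = ∫ s in (0 : ℝ)..t, f (s + r) := by
      refine intervalIntegral.integral_congr fun s hs => ?_
      rw [Set.uIcc_of_le ht.le] at hs
      simp only [hf]
      rw [Real.toNNReal_add hs.1 r.coe_nonneg, Real.toNNReal_coe, T.map_add]
    -- After the shift only two windows of length `r` survive, so the difference stays bounded as
    -- `t` grows.
    have h2 : (∫ s in (0 : ℝ)..t, f (s + r)) - ∫ s in (0 : ℝ)..t, f s
        = (∫ s in t..(t + r), f s) - ∫ s in (0 : ℝ)..r, f s := by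
      rw [intervalIntegral.integral_comp_add_right, zero_add]
      have e1 := intervalIntegral.integral_add_adjacent_intervals (hint 0 r) (hint r (t + r))
      have e2 := intervalIntegral.integral_add_adjacent_intervals (hint 0 t) (hint t (t + r))
      linear_combination e1 - e2
    have h3 : ‖∫ s in t..(t + r), f s‖ ≤ ‖traceMul x‖ * r := by
      have := intervalIntegral.norm_integral_le_of_norm_le_const (a := t) (b := t + r)
        fun s _ => hbound s
      rwa [add_sub_cancel_left, abs_of_nonneg r.coe_nonneg] at this
    have h4 : ‖∫ s in (0 : ℝ)..r, f s‖ ≤ ‖traceMul x‖ * r := by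
      have := intervalIntegral.norm_integral_le_of_norm_le_const (a := 0) (b := (r : ℝ))
        fun s _ => hbound s
      rwa [sub_zero, abs_of_nonneg r.coe_nonneg] at this
    rw [T.traceMul_cesaroMean hη, T.traceMul_cesaroMean hη, ← smul_sub, h1, h2, norm_smul,
      Real.norm_of_nonneg (by positivity)]
    gcongr
    exact (norm_sub_le _ _).trans (by linarith)
  refine squeeze_zero_norm' ((eventually_gt_atTop 0).mono hdiff) ?_
  simpa using tendsto_inv_atTop_zero.mul_const (2 * (‖traceMul (H := H) x‖ * (r : ℝ)))

/-- In the presence of a faithful invariant density the orbit of every density is tight. -/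
lemma exists_traceMul_predual_le {ρ η : TraceClass H} (hρ : IsDensity ρ) (hfaith : IsFaithful ρ)
    (hinv : T.IsInvariant ρ) (hη : IsDensity η) {ε : ℝ} (hε : 0 < ε) :
    ∃ F : Finset (basisIndex H), ∀ s, (traceMul (1 - basisProj F) (T.predual s η)).re ≤ ε := by
  obtain ⟨c, hc⟩ := exists_re_traceMul_le hρ.nonneg hfaith hη.nonneg (half_pos hε)
  have hlim : Tendsto (fun F => c * (traceMul (1 - basisProj F) ρ).re) atTop (𝓝 0) := by
    simpa using (tendsto_traceMul_one_sub_basisProj ρ).const_mul c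
  obtain ⟨F, hF⟩ := ((tendsto_order.1 hlim).2 (ε / 2) (half_pos hε)).exists
  refine ⟨F, fun s => ?_⟩
  -- Positivity and `𝒯ₛ(1) = 1` keep the test operator between `0` and `1`; invariance of `ρ` then
  -- removes `s` from the bound.
  have h1 := hc (T.map s (1 - basisProj F)) (map_nonneg (T.map s) (one_sub_basisProj_nonneg F)) (by
    have := OrderHomClass.mono (T.map s)
      (show 1 - basisProj F ≤ 1 from sub_le_self 1 (basisProj_nonneg F))
    rwa [T.map_one] at this)
  rw [← traceMul_predual, ← traceMul_predual, hinv s] at h1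
  linarith

/-! ### Uniqueness of the cluster point and convergence. -/

/-- The faithful invariant density of a primitive semigroup is its only invariant density. -/
lemma IsPrimitive.eq_of_isInvariant {T : QuantumMarkovSemigroup H} (hT : T.IsPrimitive)
    {ρ σ : TraceClass H} (hρ : IsDensity ρ) (hfaith : IsFaithful ρ) (hinv : T.IsInvariant ρ)
    (hσ : IsDensity σ) (hσinv : T.IsInvariant σ) : σ = ρ := by
  set τ : TraceClass H := (1 / 2 : ℝ) • ρ + (1 / 2 : ℝ) • σ with hτ
  have h1 : IsDensity τ :=
    convex_setOf_isDensity hρ hσ (by norm_num) (by norm_num) (by norm_num)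
  have h2 : IsFaithful τ := IsFaithful.of_smul_add hρ.nonneg hfaith hσ.nonneg
    (a := 1 / 2) (by norm_num) (by rw [hτ, _root_.map_add, toOp_real_smul, toOp_real_smul])
  -- `predual` is a bare function obtained by choice, so its action on the midpoint is computed by
  -- duality.
  have h3 : T.IsInvariant τ := fun t => ext_traceMul fun x => by
    rw [traceMul_predual, hτ, _root_.map_add, _root_.map_add, traceMul_real_smul, traceMul_real_smul,
      traceMul_real_smul, traceMul_real_smul, ← traceMul_predual, ← traceMul_predual, hinv t,
      hσinv t]
  have h4 : τ = ρ := hT.unique ⟨h1, h2, h3⟩ ⟨hρ, hfaith, hinv⟩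
  have h5 : (1 / 2 : ℝ) • σ = (1 / 2 : ℝ) • ρ := by
    have h6 : (1 / 2 : ℝ) • ρ + (1 / 2 : ℝ) • σ = (1 / 2 : ℝ) • ρ + (1 / 2 : ℝ) • ρ := by
      rw [← hτ, h4, ← add_smul]
      norm_num
    exact add_left_cancel h6
  exact smul_right_injective _ (by norm_num : (1 / 2 : ℝ) ≠ 0) h5

/-- The continuous defect `tr (τ 𝒯ᵣ(x)) - tr (τ x)` tends to zero along the means, so its value at
`σ`, a cluster value of a convergent family, is zero. -/
lemma isInvariant_of_mapClusterPt {η σ : TraceClass H} (hη : IsDensity η)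
    (hσ : MapClusterPt σ atTop (T.cesaroMean η)) : T.IsInvariant σ := by
  refine fun r => ext_traceMul fun x => ?_
  rw [traceMul_predual, ← sub_eq_zero]
  have h1 := hσ.continuousAt_comp (f := fun τ => traceMul (T.map r x) τ - traceMul x τ)
    (by fun_prop)
  have h2 := T.tendsto_traceMul_map_cesaroMean_sub hη r x
  exact (eq_of_nhds_neBot (h1.clusterPt.mono h2)).symm ▸ rfl

lemma tendsto_cesaroMean {ρ η : TraceClass H} (hT : T.IsPrimitive) (hρ : IsDensity ρ)
    (hfaith : IsFaithful ρ) (hinv : T.IsInvariant ρ) (hη : IsDensity η) :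
    Tendsto (T.cesaroMean η) atTop (𝓝 ρ) := by
  set S : Set (TraceClass H) := T.cesaroMean η '' Set.Ioi 0 with hS
  have hSd : ∀ σ ∈ S, IsDensity σ := by
    rintro _ ⟨t, ht, rfl⟩
    exact T.isDensity_cesaroMean hη ht
  have htb : TotallyBounded S := by
    refine totallyBounded_of_tight hSd fun ε hε => ?_
    obtain ⟨F, hF⟩ := T.exists_traceMul_predual_le hρ hfaith hinv hη hε
    refine ⟨F, ?_⟩
    rintro _ ⟨t, ht, rfl⟩
    exact T.cesaroMean_mem hη (convex_setOf_re_traceMul_le _ ε)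
      (isClosed_le (Complex.continuous_re.comp (traceMul _).continuous) continuous_const) hF ht
  -- Completeness of the trace norm enters here.
  have hcpt : IsCompact (closure S) := htb.closure.isCompact_of_isClosed isClosed_closure
  refine hcpt.tendsto_nhds_of_unique_mapClusterPt ?_ fun σ hσ hcl => ?_
  · filter_upwards [eventually_gt_atTop 0] with t ht
    exact subset_closure ⟨t, ht, rfl⟩
  · exact hT.eq_of_isInvariant hρ hfaith hinv
      (closure_minimal hSd isClosed_setOf_isDensity hσ) (T.isInvariant_of_mapClusterPt hη hcl)

end QuantumMarkovSemigroup

end QuantumMarkov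

end

theorem theorem5p4 {H : Type*} [NormedAddCommGroup H] [InnerProductSpace ℂ H] [CompleteSpace H]
    [TopologicalSpace.SeparableSpace H]
    (T : QuantumMarkov.QuantumMarkovSemigroup H) (hT : T.IsPrimitive)
    (ρ : QuantumMarkov.TraceClass H) (hρ : QuantumMarkov.IsDensity ρ)
    (hρ_faithful : QuantumMarkov.IsFaithful ρ) (hρ_inv : T.IsInvariant ρ)
    (η : QuantumMarkov.TraceClass H) (hη : QuantumMarkov.IsDensity η) :
    (∀ t : ℝ, 0 < t →
      IntervalIntegrable (fun s : ℝ => T.predual s.toNNReal η) MeasureTheory.volume 0 t ∧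
      QuantumMarkov.IsDensity (T.cesaroMean η t)) ∧
    Filter.Tendsto (T.cesaroMean η) Filter.atTop (nhds ρ) :=
  ⟨fun t ht => ⟨T.intervalIntegrable_predual hη 0 t, T.isDensity_cesaroMean hη ht⟩,
    T.tendsto_cesaroMean hT hρ hρ_faithful hρ_inv hη⟩
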